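/- Let $\Omega=\{1,2\}^{\mathbb Z}$ with the product topology and the coordinatewise order, and let $\Omega_f$ be the set of $\eta\in\Omega$ with $\eta(x)=2$ for only finitely many $x$. For $\eta\in\Omega_f$ and $i\in\mathbb Z$ let $T_i\eta$ be the configuration obtained by adding one grain at $i$ and stabilizing: with $k^+=\min\{j\ge 0:\eta(i+j)=1\}$, $k^-=\min\{j>0:\eta(i-j)=1\}$ and $e_x$ the indicator of $x$, one has $T_i\eta=\eta+e_i$ if $\eta(i)=1$ and $T_i\eta=\eta+e_{i+k^+}+e_{i-k^-}-e_{i+k^+-k^-}$ if $\eta(i)=2$. For $n\ge 0$ let $S_n(t)$ be the semigroup of the (non-explosive) continuous-time Markov chain on $\Omega_f$ with generator $$L^{(n)}f(\eta)=\sum_{i:\,\eta(i)=2}\bigl[f(T_i\eta)-f(\eta)\bigr]+\sum_{|i|\le n,\ \eta(i)=1}\bigl[f(T_i\eta)-f(\eta)\bigr].$$ The sandpile process is the Markov process on $\Omega$ whose transition semigroup $S(t)$, $t\ge0$, is the unique semigroup of Markov kernels on $\Omega$ (with $S(0)$ the identity) such that $$S(t)f(\eta)=\lim_{n\to\infty}\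 \lim_{m\to\infty}S_n(t)f(\eta^{m})$$ for all $t\ge 0$, all $\eta\in\Omega$ and all continuous increasing $f:\Omega\to\mathbb R$, where $\eta^{m}$ equals $\eta$ on $[-m,m]$ and $1$ elsewhere (such a semigroup exists, the limits included). Then the sandpile process is not Feller: there are $t\ge 0$ and a continuous $f:\Omega\to\mathbb R$ for which $S(t)f$ is not continuous, and it is also not true that $S(t)f\to f$ pointwise as $t\downarrow0$ for every continuous $f$. Moreover, if $\eta\in\Omega$ has only finitely many, but at least one, sites with $\eta(x)=1$, then the process started from $\eta$ has no right-continuous version. That is, processes $(X_t)_{t\ge0}$ with $X_0=\eta$ almost surely that are Markov with transition semigroup $S(t)$ exist, but none of them, on any probability space, has almost surely right-continuous paths. -/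

import Mathlib

open MeasureTheory ProbabilityTheory Filter Topology
open scoped NNReal ENNReal

noncomputable section

namespace Sandpile

/-! ### Configurations -/

/-- The two possible heights `1` and `2` of a site. -/
abbrev Height : Type := ↥({1, 2} : Finset ℕ)

/-- The state space `{1, 2}^ℤ`; it carries the product topology, the product (= Borel)
σ-algebra and the coordinatewise order. -/
abbrev Config : Type := ℤ → Height

def one : Height := ⟨1, by decide⟩

def two : Height := ⟨2, by decide⟩

/-- The configuration whose set of critical sites (sites of height `2`) is the finite set `A`. -/
def ofCritical (A : Finset ℤ) : Config := fun x => if x ∈ A then two else one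

/-- The critical sites of `η` inside `[-m, m]`. Thus `ofCritical (critical m η)` equals `η` on
`[-m, m]` and `1` elsewhere; it increases to `η` as `m → ∞`. -/
def critical (m : ℕ) (η : Config) : Finset ℤ :=
  (Finset.Icc (-(m : ℤ)) m).filter (fun x => η x = two)

/-- The set of sites of height `1`. -/
def ones (η : Config) : Set ℤ := {x | η x = one}

/-! ### Toppling

A configuration with finitely many critical sites is identified with its set `A` of critical
sites. -/

/-- `min {j ≥ 0 : η (i + j) = 1}`; the set is nonempty because `A` is finite. -/
def kPlus (i : ℤ) (A : Finset ℤ) : ℕ := sInf {j : ℕ | i + (j : ℤ) ∉ A}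

/-- `min {j > 0 : η (i - j) = 1}`; the set is nonempty because `A` is finite. -/
def kMinus (i : ℤ) (A : Finset ℤ) : ℕ := sInf {j : ℕ | 0 < j ∧ i - (j : ℤ) ∉ A}

/-- The toppling transformation `T_i`: add a grain at `i` and stabilize.
If `η i = 1` the site `i` becomes critical. If `η i = 2` the avalanche adds one grain to each of
the nearest sites of height `1` to the right and to the left of `i`, and turns the site
`i + k⁺ - k⁻` into a site of height `1`. -/
def topple (i : ℤ) (A : Finset ℤ) : Finset ℤ :=
  if i ∈ A then
    insert (i + (kPlus i A : ℤ)) (insert (i - (kMinus i A : ℤ))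
      (A.erase (i + (kPlus i A : ℤ) - (kMinus i A : ℤ))))
  else insert i A

/-! ### The approximating Markov chain

It has the generator
`L⁽ⁿ⁾ f(η) = ∑_{i : η i = 2} (f(T_i η) - f(η)) + ∑_{|i| ≤ n, η i = 1} (f(T_i η) - f(η))`
on configurations with finitely many critical sites. -/

/-- The sites at which grains are added (each at rate one) when the critical sites are `A`:
all critical sites (avalanches) and all sites of `[-n, n]` (births). -/
def active (n : ℕ) (A : Finset ℤ) : Finset ℤ := A ∪ Finset.Icc (-(n : ℤ)) n

/-- The probability that the continuous time Markov chain with generator `L⁽ⁿ⁾`, started at `A`,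
makes exactly `k` jumps during `[0, t]` and is at `B` at time `t`. It is given by conditioning on
the first jump: the chain stays at `A` for an exponential time of rate `|active n A|` and then
moves to `T_i A`, with `i` uniform on `active n A`. -/
def jumpProb (n : ℕ) : ℕ → ℝ → Finset ℤ → Finset ℤ → ℝ≥0∞
  | 0, t, A, B => if A = B then ENNReal.ofReal (Real.exp (-((active n A).card : ℝ) * t)) else 0
  | k + 1, t, A, B =>
      ∫⁻ s in Set.Ioc 0 t, ENNReal.ofReal (Real.exp (-((active n A).card : ℝ) * s)) *
        ∑ i ∈ active n A, jumpProb n k (t - s) (topple i A) B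

/-- The transition function of the (non-exploding) chain with generator `L⁽ⁿ⁾`. -/
def transProb (n : ℕ) (t : ℝ) (A B : Finset ℤ) : ℝ≥0∞ := ∑' k : ℕ, jumpProb n k t A B

/-- The law at time `t` of the chain with generator `L⁽ⁿ⁾` started at `A`, as a measure on
configurations. -/
def chainLaw (n : ℕ) (t : ℝ) (A : Finset ℤ) : Measure Config :=
  Measure.sum fun B : Finset ℤ => transProb n t A B • Measure.dirac (ofCritical B)

/-- The semigroup `S_n(t) f` of the chain with generator `L⁽ⁿ⁾`, at the configuration with
critical set `A`. -/
def semigroupApprox (n : ℕ) (t : ℝ≥0) (f : Config → ℝ) (A : Finset ℤ) : ℝ :=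
  ∫ ξ, f ξ ∂(chainLaw n t A)

/-! ### The sandpile process -/

/-- `(P t)` is the transition semigroup `S(t)` of the one-dimensional sandpile process: a Markov
semigroup on configurations with
`S(t) f(η) = lim_n lim_{η' ↑ η} S_n(t) f(η')` for all continuous increasing `f`, where the inner
limit is along the restrictions `η'` of `η` to `[-m, m]`, `m → ∞`. (Existence of both limits is part
of the assertion.) -/
structure IsSandpileSemigroup (P : ℝ≥0 → Kernel Config Config) : Prop where
  isMarkovKernel : ∀ t, IsMarkovKernel (P t)
  zero : P 0 = Kernel.id
  add : ∀ s t, P (s + t) = P t ∘ₖ P s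
  limit : ∀ (t : ℝ≥0) (f : Config → ℝ), Continuous f → Monotone f → ∀ η : Config,
    ∃ g : ℕ → ℝ,
      (∀ n, Tendsto (fun m : ℕ => semigroupApprox n t f (critical m η)) atTop (𝓝 (g n))) ∧
      Tendsto g atTop (𝓝 (∫ ξ, f ξ ∂(P t η)))

/-- The Feller property: every `S(t)` maps continuous functions to continuous functions. -/
def FellerProperty (P : ℝ≥0 → Kernel Config Config) : Prop :=
  ∀ (t : ℝ≥0) (f : Config → ℝ), Continuous f → Continuous fun η => ∫ ξ, f ξ ∂(P t η)

/-- Continuity of the semigroup at time `0`: `S(t) f → f` pointwise as `t ↓ 0` for every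
continuous `f`. (For semigroups with the Feller property this is equivalent to uniform
convergence.) -/
def ContinuousAtZero (P : ℝ≥0 → Kernel Config Config) : Prop :=
  ∀ f : Config → ℝ, Continuous f → ∀ η : Config,
    Tendsto (fun t : ℝ≥0 => ∫ ξ, f ξ ∂(P t η)) (𝓝[>] 0) (𝓝 (f η))

/-- The σ-algebra generated by `X r`, `r ≤ s`. -/
abbrev past {S : Type*} (X : ℝ≥0 → S → Config) (s : ℝ≥0) : MeasurableSpace S :=
  ⨆ r ∈ Set.Iic s, MeasurableSpace.comap (X r) inferInstance

/-- `X` is a version of the Markov process with transition semigroup `P` started at `η`: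
a process on the probability space `(S, μ)` with `X 0 = η` almost surely and
`μ(X (s + t) ∈ B | X r, r ≤ s) = P t (X s, B)`. This says exactly that `X` has the
finite-dimensional distributions determined by `P` and `η`. -/
structure IsVersion (P : ℝ≥0 → Kernel Config Config) (η : Config)
    {S : Type*} [MeasurableSpace S] (μ : Measure S) (X : ℝ≥0 → S → Config) : Prop where
  isProbabilityMeasure : IsProbabilityMeasure μ
  measurable : ∀ t, Measurable (X t)
  initial : ∀ᵐ ω ∂μ, X 0 ω = η
  markov : ∀ (s t : ℝ≥0) (B : Set Config), MeasurableSet B →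
    μ[(X (s + t) ⁻¹' B).indicator (fun _ => (1 : ℝ)) | past X s]
      =ᵐ[μ] fun ω => (P t (X s ω)).real B

/-- Almost all paths of `X` are right-continuous. -/
def HasRightContinuousPaths {S : Type*} [MeasurableSpace S] (μ : Measure S)
    (X : ℝ≥0 → S → Config) : Prop :=
  ∀ᵐ ω ∂μ, ∀ t : ℝ≥0, ContinuousWithinAt (fun s => X s ω) (Set.Ici t) t

end Sandpile

end

noncomputable section

namespace Sandpile

/-! ### Avalanches parametrised by the position of the new hole -/

/-! Avalanches are relabelled by the hole they leave instead of the site where they start.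
Reflection within each cluster permutes the critical sites, so the generator does not change
(`sum_active`). With the new labels, avalanches with the same hole keep two ordered configurations
ordered (`removeAt_mono`), and the resulting coupling gives attractiveness
(`expect_le_expect_of_shift`). Expectations of increasing functions are therefore monotone in the
birth window and in the initial set. Together with compactness of the space of laws this yields the
limiting semigroup. No chain is constructed pathwise. Expectations are bounded solutions of the
backward equation, and comparisons between them follow from a minimum principle
(`nonneg_of_backward_supersolution`), which applies because a jump adds at most one critical site,
so that rates grow at most linearly along jumps. The pathology comes from the infinite total
avalanche rate in the presence of infinitely many critical sites. In an interval with `M` critical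
sites and one hole, any avalanche fills that hole and opens another, so a given site is a hole with
probability of order `1 / M`. With finitely many holes, an avalanche whose new hole is far to the
left fills the leftmost old hole (symmetrically on the right). Induction on the holes gives
`exists_expect_ge`. Hence finitely many sites of height one disappear instantly
(`limitLaw_eq_dirac`), which contradicts continuity at time zero and right-continuity of paths. For
the Feller property, configurations equal to one exactly on `[-k, k]` converge to the all-one
configuration, yet are all-two at every positive time. Started from all ones, however, the expected
number of critical sites is at most `(2n + 1)(exp t - 1)`; by translation the density at time `1 /
4` is bounded away from one (`integral_limitLaw_ofCritical_empty_ne_one`). -/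

lemma kPlus_notMem (i : ℤ) (A : Finset ℤ) : i + (kPlus i A : ℤ) ∉ A := by
  have : {j : ℕ | i + (j : ℤ) ∉ A}.Nonempty := by
    by_contra h
    rw [Set.not_nonempty_iff_eq_empty, Set.eq_empty_iff_forall_notMem] at h
    refine Set.infinite_of_injective_forall_mem (s := (A : Set ℤ)) (f := fun j : ℕ => i + (j : ℤ))
      (fun a b hab => by simpa using hab) (fun j => ?_) A.finite_toSet
    simpa using h j
  exact Nat.sInf_mem this

lemma mem_of_lt_kPlus {i : ℤ} {A : Finset ℤ} {j : ℕ} (h : j < kPlus i A) : i + (j : ℤ) ∈ A := by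
  simpa using Nat.notMem_of_lt_sInf h

lemma kMinus_spec (i : ℤ) (A : Finset ℤ) : 0 < kMinus i A ∧ i - (kMinus i A : ℤ) ∉ A := by
  have : {j : ℕ | 0 < j ∧ i - (j : ℤ) ∉ A}.Nonempty := by
    by_contra h
    rw [Set.not_nonempty_iff_eq_empty, Set.eq_empty_iff_forall_notMem] at h
    refine Set.infinite_of_injective_forall_mem (s := (A : Set ℤ))
      (f := fun j : ℕ => i - ((j + 1 : ℕ) : ℤ))
      (fun a b hab => by simpa using hab) (fun j => ?_) A.finite_toSet
    simpa using h (j + 1)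
  exact Nat.sInf_mem this

lemma kMinus_pos (i : ℤ) (A : Finset ℤ) : 0 < kMinus i A := (kMinus_spec i A).1

lemma kMinus_notMem (i : ℤ) (A : Finset ℤ) : i - (kMinus i A : ℤ) ∉ A := (kMinus_spec i A).2

lemma mem_of_lt_kMinus {i : ℤ} {A : Finset ℤ} {j : ℕ} (h0 : 0 < j) (h : j < kMinus i A) :
    i - (j : ℤ) ∈ A := by
  have := Nat.notMem_of_lt_sInf h
  simp only [Set.mem_ofPred_eq, not_and, not_not] at this
  exact this h0

lemma kPlus_pos {i : ℤ} {A : Finset ℤ} (h : i ∈ A) : 0 < kPlus i A := by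
  rcases Nat.eq_zero_or_pos (kPlus i A) with h0 | h0
  · exact absurd h (by simpa [h0] using kPlus_notMem i A)
  · exact h0

lemma mem_of_mem_cluster {i z : ℤ} {A : Finset ℤ} (hi : i ∈ A) (h1 : i - (kMinus i A : ℤ) < z)
    (h2 : z < i + (kPlus i A : ℤ)) : z ∈ A := by
  rcases lt_trichotomy i z with h | h | h
  · have := mem_of_lt_kPlus (i := i) (A := A) (j := (z - i).toNat) (by omega)
    rwa [show i + (((z - i).toNat : ℕ) : ℤ) = z by omega] at this
  · exact h ▸ hi
  · have := mem_of_lt_kMinus (i := i) (A := A) (j := (i - z).toNat) (by omega) (by omega)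
    rwa [show i - (((i - z).toNat : ℕ) : ℤ) = z by omega] at this

lemma kPlus_eq_of {i : ℤ} {A : Finset ℤ} {k : ℕ} (h : i + (k : ℤ) ∉ A)
    (h' : ∀ j < k, i + (j : ℤ) ∈ A) : kPlus i A = k := by
  apply le_antisymm
  · exact Nat.sInf_le h
  · by_contra hlt
    exact kPlus_notMem i A (h' _ (not_le.1 hlt))

lemma kMinus_eq_of {i : ℤ} {A : Finset ℤ} {k : ℕ} (hk : 0 < k) (h : i - (k : ℤ) ∉ A)
    (h' : ∀ j, 0 < j → j < k → i - (j : ℤ) ∈ A) : kMinus i A = k := by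
  apply le_antisymm
  · exact Nat.sInf_le ⟨hk, h⟩
  · by_contra hlt
    exact kMinus_notMem i A (h' _ (kMinus_pos i A) (not_le.1 hlt))

/-- The site at which an avalanche started at `i` leaves a hole: the mirror image of `i` in its
cluster. -/
def reflect (A : Finset ℤ) (i : ℤ) : ℤ := i + (kPlus i A : ℤ) - (kMinus i A : ℤ)

lemma reflect_mem {i : ℤ} {A : Finset ℤ} (hi : i ∈ A) : reflect A i ∈ A := by
  have h1 := kPlus_pos hi
  have h2 := kMinus_pos i A
  apply mem_of_mem_cluster hi <;> unfold reflect <;> omega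

/-- Reflection in the midpoint of a cluster interchanges the distances to its two ends. This makes
`reflect A` an involution of `A`. -/
lemma kPlus_reflect {i : ℤ} {A : Finset ℤ} (hi : i ∈ A) : kPlus (reflect A i) A = kMinus i A := by
  have h1 := kPlus_pos hi
  have h2 := kMinus_pos i A
  apply kPlus_eq_of
  · unfold reflect
    simpa using kPlus_notMem i A
  · intro j hj
    apply mem_of_mem_cluster hi <;> unfold reflect <;> omega

lemma kMinus_reflect {i : ℤ} {A : Finset ℤ} (hi : i ∈ A) : kMinus (reflect A i) A = kPlus i A := by
  have h1 := kPlus_pos hi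
  have h2 := kMinus_pos i A
  apply kMinus_eq_of h1
  · unfold reflect
    convert kMinus_notMem i A using 1
    ring_nf
  · intro j hj hj'
    apply mem_of_mem_cluster hi <;> unfold reflect <;> omega

lemma reflect_reflect {i : ℤ} {A : Finset ℤ} (hi : i ∈ A) : reflect A (reflect A i) = i := by
  have h1 := kPlus_reflect hi
  have h2 := kMinus_reflect hi
  rw [show reflect A (reflect A i) = reflect A i + (kPlus (reflect A i) A : ℤ) -
    (kMinus (reflect A i) A : ℤ) from rfl, h1, h2]
  unfold reflect
  ring

/-- Fill both ends of the cluster of `h` and make a hole at `h`; nothing happens if `h` already is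
a hole. -/
def removeAt (h : ℤ) (A : Finset ℤ) : Finset ℤ :=
  if h ∈ A then insert (h + (kPlus h A : ℤ)) (insert (h - (kMinus h A : ℤ)) (A.erase h)) else A

lemma topple_of_mem {i : ℤ} {A : Finset ℤ} (hi : i ∈ A) :
    topple i A = removeAt (reflect A i) A := by
  rw [removeAt, if_pos (reflect_mem hi), topple, if_pos hi, kPlus_reflect hi, kMinus_reflect hi]
  have h1 : reflect A i + (kMinus i A : ℤ) = i + (kPlus i A : ℤ) := by unfold reflect; ring
  have h2 : reflect A i - (kPlus i A : ℤ) = i - (kMinus i A : ℤ) := by unfold reflect; ring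
  rw [h1, h2]
  rfl

lemma card_topple_le (i : ℤ) (A : Finset ℤ) : (topple i A).card ≤ A.card + 1 := by
  by_cases hi : i ∈ A
  · rw [topple_of_mem hi, removeAt, if_pos (reflect_mem hi)]
    have h1 := Finset.card_erase_of_mem (reflect_mem hi)
    have h2 := Finset.card_pos.2 ⟨i, hi⟩
    refine (Finset.card_insert_le _ _).trans (Nat.add_le_add_right ?_ 1)
    refine (Finset.card_insert_le _ _).trans ?_
    omega
  · rw [topple, if_neg hi]
    exact Finset.card_insert_le _ _

/-- Apart from `y ≠ h`, the right-hand side is an increasing condition on `A`; monotonicity of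
`removeAt` rests on this form. -/
lemma mem_removeAt {h y : ℤ} {A : Finset ℤ} (hh : h ∈ A) :
    y ∈ removeAt h A ↔
      y ≠ h ∧ (y ∈ A ∨ ((∀ z, h < z → z < y → z ∈ A) ∧ ∀ z, y < z → z < h → z ∈ A)) := by
  have h1 := kPlus_pos hh
  have h2 := kMinus_pos h A
  rw [removeAt, if_pos hh]
  simp only [Finset.mem_insert, Finset.mem_erase]
  constructor
  · rintro (rfl | rfl | ⟨h3, h4⟩)
    · refine ⟨by omega, Or.inr ⟨fun z hz hz' => ?_, fun z hz hz' => ?_⟩⟩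
      · exact mem_of_mem_cluster hh (by omega) hz'
      · omega
    · refine ⟨by omega, Or.inr ⟨fun z hz hz' => ?_, fun z hz hz' => ?_⟩⟩
      · omega
      · exact mem_of_mem_cluster hh hz (by omega)
    · exact ⟨h3, Or.inl h4⟩
  · rintro ⟨h3, h4 | ⟨h4, h5⟩⟩
    · exact Or.inr (Or.inr ⟨h3, h4⟩)
    · by_cases hy : y ∈ A
      · exact Or.inr (Or.inr ⟨h3, hy⟩)
      · rcases lt_or_gt_of_ne h3 with h6 | h6
        · right; left
          by_contra hne
          rcases lt_or_gt_of_ne hne with h7 | h7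
          · exact kMinus_notMem h A (h5 _ h7 (by omega))
          · exact hy (mem_of_mem_cluster hh h7 (by omega))
        · left
          by_contra hne
          rcases lt_or_gt_of_ne hne with h7 | h7
          · exact hy (mem_of_mem_cluster hh (by omega) h7)
          · exact kPlus_notMem h A (h4 _ (by omega) h7)

/-- Avalanches are reindexed by the involution `reflect A`. Births may be summed over the whole
window because inserting a site that is already critical contributes zero. -/
lemma sum_active (n : ℕ) (f : Finset ℤ → ℝ) (A : Finset ℤ) :
    ∑ i ∈ active n A, (f (topple i A) - f A) =
      ∑ h ∈ A, (f (removeAt h A) - f A) +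
        ∑ h ∈ Finset.Icc (-(n : ℤ)) n, (f (insert h A) - f A) := by
  rw [active, ← Finset.union_sdiff_self_eq_union, Finset.sum_union Finset.disjoint_sdiff]
  congr 1
  · refine Finset.sum_nbij' (reflect A) (reflect A) (fun i hi => reflect_mem hi)
      (fun i hi => reflect_mem hi) (fun i hi => reflect_reflect hi)
      (fun i hi => reflect_reflect hi) (fun i hi => ?_)
    rw [topple_of_mem hi]
  · refine Finset.sum_subset_zero_on_sdiff Finset.sdiff_subset (fun h hh => ?_) (fun h hh => ?_)
    · have : h ∈ A := by
        simp only [Finset.mem_sdiff, not_and, not_not] at hh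
        exact hh.2 hh.1
      rw [Finset.insert_eq_of_mem this, sub_self]
    · rw [topple, if_neg (Finset.mem_sdiff.1 hh).2]

/-- The basis of the coupling: the new hole is at the same place in both configurations, and sites
filled in the smaller one are filled or already critical in the larger one. The translation by `x`
later permits comparing different sites. -/
lemma removeAt_mono {A A' : Finset ℤ} {x h : ℤ} (hA : ∀ y ∈ A, y + x ∈ A') :
    ∀ y ∈ removeAt (h - x) A, y + x ∈ removeAt h A' := by
  intro y hy
  by_cases h1 : h - x ∈ A
  · have h1' : h ∈ A' := by simpa using hA _ h1
    rw [mem_removeAt h1] at hy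
    rw [mem_removeAt h1']
    refine ⟨fun h2 => hy.1 (by omega), ?_⟩
    rcases hy.2 with h2 | ⟨h2, h3⟩
    · exact Or.inl (hA _ h2)
    · refine Or.inr ⟨fun z hz hz' => ?_, fun z hz hz' => ?_⟩
      · simpa using hA _ (h2 (z - x) (by omega) (by omega))
      · simpa using hA _ (h3 (z - x) (by omega) (by omega))
  · rw [removeAt, if_neg h1] at hy
    by_cases h1' : h ∈ A'
    · rw [mem_removeAt h1']
      exact ⟨fun h2 => h1 (by rwa [show h - x = y by omega]), Or.inl (hA _ hy)⟩
    · rw [removeAt, if_neg h1']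
      exact hA _ hy

lemma removeAt_of_notMem {A : Finset ℤ} {h : ℤ} (hh : h ∉ A) : removeAt h A = A := if_neg hh

lemma card_removeAt_le (h : ℤ) (A : Finset ℤ) : (removeAt h A).card ≤ A.card + 1 := by
  by_cases hh : h ∈ A
  · have := card_topple_le (reflect A h) A
    rwa [topple_of_mem (reflect_mem hh), reflect_reflect hh] at this
  · rw [removeAt_of_notMem hh]
    exact Nat.le_succ _

/-! ### A minimum principle for non-explosive jump processes -/

/-- A supersolution of the backward equation of a jump process with rates growing at most linearly
along jumps stays nonnegative, provided it is bounded below. -/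
theorem nonneg_of_backward_supersolution {X ι : Type*} (C : X → Prop) (I : X → Finset ι)
    (F : ι → X → X) (φ : X → ℝ) (w w' : ℝ → X → ℝ) (K : ℝ)
    (hC : ∀ x, C x → ∀ i ∈ I x, C (F i x))
    (hφ0 : ∀ x, 0 ≤ φ x) (hI : ∀ x, ((I x).card : ℝ) ≤ φ x)
    (hφ : ∀ x, C x → ∀ i ∈ I x, φ (F i x) ≤ φ x + 1)
    (hcont : ∀ x, C x → ContinuousOn (fun t => w t x) (Set.Ici 0))
    (hderiv : ∀ x, C x → ∀ t, 0 < t → HasDerivAt (fun t => w t x) (w' t x) t)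
    (hw' : ∀ x, C x → ∀ t, 0 < t → ∑ i ∈ I x, (w t (F i x) - w t x) ≤ w' t x)
    (hK : ∀ x, C x → ∀ t, 0 ≤ t → -K ≤ w t x) (h0 : ∀ x, C x → 0 ≤ w 0 x) :
    ∀ x, C x → ∀ t, 0 ≤ t → 0 ≤ w t x := by
  -- The lower bound is improved by following `k` jumps. The induction hypothesis after one jump
  -- gives the factor `(φ + 2) / (φ + 2 + k)`, the jump itself costs `q / (q + 1) ≤ (φ + 1) / (φ +
  -- 2)`, and the product is the claimed factor for `k + 1`. It tends to zero as `k → ∞`.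
  have hKpos : ∀ k : ℕ, ∀ x, C x → ∀ t, 0 ≤ t →
      -(|K| * Real.exp t * ((φ x + 1) / (φ x + 1 + k))) ≤ w t x := by
    intro k
    induction k with
    | zero =>
      intro x hx t ht
      have h1 := hK x hx t ht
      have h2 : 1 ≤ Real.exp t := Real.one_le_exp ht
      have h3 : (φ x + 1) / (φ x + 1 + (0 : ℕ)) = 1 := by
        have := hφ0 x
        rw [Nat.cast_zero, add_zero, div_self]
        positivity
      rw [h3]
      nlinarith [le_abs_self K, abs_nonneg K]
    | succ k ih =>
      intro x hx t ht
      set q : ℝ := ((I x).card : ℝ) with hq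
      have hq0 : 0 ≤ q := by positivity
      have hφx := hφ0 x
      have hqφ : q ≤ φ x := hI x
      set d : ℝ := |K| * ((φ x + 2) / (φ x + 2 + k)) with hd
      have hd0 : 0 ≤ d := by positivity
      -- The factor `q / (q + 1)` bounds `exp (-t)` times the integral of `q * exp (-q (t - s)) *
      -- exp s` over `0 < s < t`.
      set c : ℝ := d * (q / (q + 1)) with hc
      have hc0 : 0 ≤ c := by positivity
      have hstep : ∀ s, 0 < s → ∀ i ∈ I x, -(d * Real.exp s) ≤ w s (F i x) := by
        intro s hs i hi
        refine le_trans ?_ (ih (F i x) (hC x hx i hi) s hs.le)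
        have h1 := hφ x hx i hi
        have h2 := hφ0 (F i x)
        have h3 : (φ (F i x) + 1) / (φ (F i x) + 1 + k) ≤ (φ x + 2) / (φ x + 2 + k) := by
          have hk : (0 : ℝ) ≤ k := by positivity
          rw [div_le_div_iff₀ (by positivity) (by positivity)]
          nlinarith
        rw [hd, neg_le_neg_iff]
        calc |K| * Real.exp s * ((φ (F i x) + 1) / (φ (F i x) + 1 + k))
            ≤ |K| * Real.exp s * ((φ x + 2) / (φ x + 2 + k)) := by gcongr
          _ = _ := by ring
      have hsum : ∀ s, 0 < s → -(q * (d * Real.exp s)) - q * w s x ≤ w' s x := by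
        intro s hs
        refine le_trans ?_ (hw' x hx s hs)
        rw [Finset.sum_sub_distrib, Finset.sum_const, nsmul_eq_mul]
        gcongr
        have := Finset.sum_le_sum (hstep s hs)
        rw [Finset.sum_const, nsmul_eq_mul] at this
        linarith
      -- Integrating factor `exp (q s)`; the choice of `c` gives `c (q + 1) = d q`, which is what
      -- makes the derivative nonnegative.
      have hmono : MonotoneOn (fun s => Real.exp (q * s) * w s x + c * Real.exp ((q + 1) * s))
          (Set.Ici 0) := by
        have hder : ∀ s, 0 < s → HasDerivAt
            (fun s => Real.exp (q * s) * w s x + c * Real.exp ((q + 1) * s))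
            (Real.exp (q * s) * (q * 1) * w s x + Real.exp (q * s) * w' s x +
              c * (Real.exp ((q + 1) * s) * ((q + 1) * 1))) s := by
          intro s hs
          have e1 := ((hasDerivAt_id s).const_mul q).exp
          have e2 := (((hasDerivAt_id s).const_mul (q + 1)).exp).const_mul c
          exact (e1.mul (hderiv x hx s hs)).add e2
        apply monotoneOn_of_deriv_nonneg (convex_Ici 0)
        · have := hcont x hx
          fun_prop
        · rw [interior_Ici]
          intro s hs
          exact (hder s hs).differentiableAt.differentiableWithinAt
        · rw [interior_Ici]
          intro s hs
          rw [(hder s hs).deriv]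
          have h1 := hsum s hs
          have h2 : Real.exp ((q + 1) * s) = Real.exp (q * s) * Real.exp s := by
            rw [← Real.exp_add]; ring_nf
          have h3 : c * (q + 1) = d * q := by
            rw [hc]; field_simp
          have h4 : Real.exp (q * s) * (q * 1) * w s x + Real.exp (q * s) * w' s x +
              c * (Real.exp ((q + 1) * s) * ((q + 1) * 1)) =
              Real.exp (q * s) * (q * w s x + w' s x + (c * (q + 1)) * Real.exp s) := by
            rw [h2]; ring
          rw [h4, h3]
          apply mul_nonneg (Real.exp_pos _).le
          nlinarith
      have h1 := hmono (Set.mem_Ici.2 le_rfl) (Set.mem_Ici.2 ht) ht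
      have h2 := h0 x hx
      have h3 : 0 ≤ Real.exp (q * t) * w t x + c * Real.exp ((q + 1) * t) := by
        refine le_trans ?_ h1
        simp only [mul_zero, Real.exp_zero]
        linarith
      have h4 : Real.exp ((q + 1) * t) = Real.exp (q * t) * Real.exp t := by
        rw [← Real.exp_add]; ring_nf
      have h5 : 0 ≤ w t x + c * Real.exp t := by
        have : Real.exp (q * t) * w t x + c * Real.exp ((q + 1) * t) =
          Real.exp (q * t) * (w t x + c * Real.exp t) := by rw [h4]; ring
        rw [this] at h3
        exact nonneg_of_mul_nonneg_right h3 (Real.exp_pos _)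
      have h6 : c ≤ |K| * ((φ x + 1) / (φ x + 1 + (k + 1 : ℕ))) := by
        have h7 : q / (q + 1) ≤ (φ x + 1) / (φ x + 2) := by
          rw [div_le_div_iff₀ (by positivity) (by positivity)]
          nlinarith
        calc c ≤ |K| * ((φ x + 2) / (φ x + 2 + k)) * ((φ x + 1) / (φ x + 2)) := by
              rw [hc, hd]; gcongr
          _ = |K| * ((φ x + 1) / (φ x + 1 + (k + 1 : ℕ))) := by
              rw [show φ x + 1 + ((k + 1 : ℕ) : ℝ) = φ x + 2 + k by push_cast; ring]
              field_simp
      nlinarith [Real.exp_pos t, mul_le_mul_of_nonneg_right h6 (Real.exp_pos t).le]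
  intro x hx t ht
  have hlim : Tendsto (fun k : ℕ => -(|K| * Real.exp t * ((φ x + 1) / (φ x + 1 + k)))) atTop
      (𝓝 (-(|K| * Real.exp t * 0))) := by
    refine Tendsto.neg (Tendsto.const_mul _ ?_)
    exact tendsto_const_nhds.div_atTop
      (tendsto_atTop_add_const_left _ _ tendsto_natCast_atTop_atTop)
  rw [mul_zero, neg_zero] at hlim
  exact le_of_tendsto' hlim fun k => hKpos k x hx t ht

/-! ### The backward equation of the approximating chain -/

lemma measurable_jumpProb (n k : ℕ) (A B : Finset ℤ) :
    Measurable fun t => jumpProb n k t A B := by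
  induction k generalizing A with
  | zero =>
    simp only [jumpProb]
    split_ifs
    · fun_prop
    · fun_prop
  | succ k ih =>
    simp only [jumpProb]
    have h : ∀ t : ℝ, ∫⁻ s in Set.Ioc 0 t,
        ENNReal.ofReal (Real.exp (-((active n A).card : ℝ) * s)) *
        ∑ i ∈ active n A, jumpProb n k (t - s) (topple i A) B =
        ∫⁻ s, {p : ℝ × ℝ | 0 < p.2 ∧ p.2 ≤ p.1}.indicator (fun p =>
          ENNReal.ofReal (Real.exp (-((active n A).card : ℝ) * p.2)) *
          ∑ i ∈ active n A, jumpProb n k (p.1 - p.2) (topple i A) B) (t, s) := by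
      intro t
      rw [← lintegral_indicator measurableSet_Ioc]
      rfl
    simp_rw [h]
    apply Measurable.lintegral_prod_right'
    apply Measurable.indicator
    · apply Measurable.mul (by fun_prop)
      refine Finset.measurable_sum _ fun i _ => ?_
      exact (ih (topple i A)).comp (measurable_fst.sub measurable_snd)
    · exact (measurableSet_lt measurable_const measurable_snd).inter
        (measurableSet_le measurable_snd measurable_fst)

/-- The contribution to the expectation of `g` at time `t` of the paths with exactly `k` jumps. -/
def jumpExpect (n k : ℕ) (t : ℝ) (g : Finset ℤ → ℝ≥0∞) (A : Finset ℤ) : ℝ≥0∞ :=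
  ∑' B, jumpProb n k t A B * g B

lemma measurable_jumpExpect (n k : ℕ) (g : Finset ℤ → ℝ≥0∞) (A : Finset ℤ) :
    Measurable fun t => jumpExpect n k t g A :=
  Measurable.tsum fun B => (measurable_jumpProb n k A B).mul_const _

lemma jumpExpect_zero (n : ℕ) (t : ℝ) (g : Finset ℤ → ℝ≥0∞) (A : Finset ℤ) :
    jumpExpect n 0 t g A = ENNReal.ofReal (Real.exp (-((active n A).card : ℝ) * t)) * g A := by
  rw [jumpExpect, tsum_eq_single A]
  · simp [jumpProb]
  · intro B hB
    simp [jumpProb, hB.symm]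

lemma jumpExpect_succ (n k : ℕ) (t : ℝ) (g : Finset ℤ → ℝ≥0∞) (A : Finset ℤ) :
    jumpExpect n (k + 1) t g A =
      ∫⁻ s in Set.Ioc 0 t, ENNReal.ofReal (Real.exp (-((active n A).card : ℝ) * s)) *
        ∑ i ∈ active n A, jumpExpect n k (t - s) g (topple i A) := by
  have hm : ∀ B, Measurable fun s => ENNReal.ofReal (Real.exp (-((active n A).card : ℝ) * s)) *
        ∑ i ∈ active n A, jumpProb n k (t - s) (topple i A) B := by
    intro B
    apply Measurable.mul (by fun_prop)
    refine Finset.measurable_sum _ fun i _ => ?_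
    exact (measurable_jumpProb n k (topple i A) B).comp (measurable_const.sub measurable_id)
  simp only [jumpExpect, jumpProb]
  simp_rw [← lintegral_mul_const _ (hm _)]
  rw [← lintegral_tsum fun B => ((hm B).mul_const _).aemeasurable]
  refine lintegral_congr fun s => ?_
  simp_rw [mul_assoc]
  rw [ENNReal.tsum_mul_left]
  congr 1
  simp_rw [Finset.sum_mul]
  rw [Summable.tsum_finsetSum fun i _ => ENNReal.summable]

/-- An exponential clock of rate `q` rings either after `t` or during `(0, t]`. -/
lemma lintegral_exp_mul_add (q : ℕ) {t : ℝ} (ht : 0 ≤ t) :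
    ENNReal.ofReal (Real.exp (-(q : ℝ) * t)) +
      ∫⁻ s in Set.Ioc 0 t, ENNReal.ofReal (Real.exp (-(q : ℝ) * s)) * (q : ℝ≥0∞) = 1 := by
  have h1 : ∫ s in (0 : ℝ)..t, Real.exp (-(q : ℝ) * s) * q = 1 - Real.exp (-(q : ℝ) * t) := by
    have hd : ∀ s ∈ Set.uIcc 0 t, HasDerivAt (fun s => -Real.exp (-(q : ℝ) * s))
        (Real.exp (-(q : ℝ) * s) * q) s := by
      intro s _
      have := (((hasDerivAt_id s).const_mul (-(q : ℝ))).exp).neg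
      refine this.congr_deriv ?_
      simp only [id]
      ring
    rw [intervalIntegral.integral_eq_sub_of_hasDerivAt hd
      (Continuous.intervalIntegrable (by fun_prop) _ _)]
    simp
    ring
  rw [intervalIntegral.integral_of_le ht] at h1
  have h2 : ∫⁻ s in Set.Ioc 0 t, ENNReal.ofReal (Real.exp (-(q : ℝ) * s)) * (q : ℝ≥0∞) =
      ENNReal.ofReal (∫ s in Set.Ioc 0 t, Real.exp (-(q : ℝ) * s) * q) := by
    rw [ofReal_integral_eq_lintegral_ofReal]
    · refine lintegral_congr fun s => ?_
      rw [ENNReal.ofReal_mul (Real.exp_pos _).le, ENNReal.ofReal_natCast]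
    · exact (Continuous.integrableOn_Icc (by fun_prop)).mono_set Set.Ioc_subset_Icc_self
    · exact Eventually.of_forall fun s => by positivity
  have h3 : Real.exp (-(q : ℝ) * t) ≤ 1 := by
    rw [Real.exp_le_one_iff]
    have : (0 : ℝ) ≤ q * t := by positivity
    linarith
  rw [h2, h1, ← ENNReal.ofReal_add (Real.exp_pos _).le (by linarith)]
  simp

lemma sum_jumpExpect_le (n m : ℕ) (g : Finset ℤ → ℝ≥0∞) (K : ℝ≥0∞) (hg : ∀ A, g A ≤ K)
    (A : Finset ℤ) {t : ℝ} (ht : 0 ≤ t) : ∑ k ∈ Finset.range m, jumpExpect n k t g A ≤ K := by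
  induction m generalizing A t with
  | zero => simp
  | succ m ih =>
    rw [Finset.sum_range_succ', jumpExpect_zero]
    simp_rw [jumpExpect_succ]
    rw [← lintegral_finsetSum]
    · have h1 : ∫⁻ s in Set.Ioc 0 t, ∑ k ∈ Finset.range m,
          ENNReal.ofReal (Real.exp (-((active n A).card : ℝ) * s)) *
            ∑ i ∈ active n A, jumpExpect n k (t - s) g (topple i A) ≤
          ∫⁻ s in Set.Ioc 0 t, (ENNReal.ofReal (Real.exp (-((active n A).card : ℝ) * s)) *
            ((active n A).card : ℝ≥0∞)) * K := by
        refine setLIntegral_mono' measurableSet_Ioc fun s hs => ?_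
        rw [← Finset.mul_sum, Finset.sum_comm, mul_assoc]
        gcongr
        refine (Finset.sum_le_sum fun i _ => ih (topple i A) (sub_nonneg.2 hs.2)).trans ?_
        rw [Finset.sum_const, nsmul_eq_mul]
      rw [lintegral_mul_const _ (by fun_prop)] at h1
      calc _ ≤ _ + ENNReal.ofReal (Real.exp (-((active n A).card : ℝ) * t)) * K :=
            add_le_add h1 (by gcongr; exact hg A)
        _ = K := by
            rw [← add_mul, add_comm, lintegral_exp_mul_add _ ht, one_mul]
    · intro k _
      apply Measurable.mul (by fun_prop)
      refine Finset.measurable_sum _ fun i _ => ?_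
      exact (measurable_jumpExpect n k g (topple i A)).comp (measurable_const.sub measurable_id)

/-- The expectation of `g ≥ 0` at time `t` for the chain started at `A`. -/
def lexpect (n : ℕ) (t : ℝ) (g : Finset ℤ → ℝ≥0∞) (A : Finset ℤ) : ℝ≥0∞ :=
  ∑' B, transProb n t A B * g B

lemma lexpect_eq_tsum (n : ℕ) (t : ℝ) (g : Finset ℤ → ℝ≥0∞) (A : Finset ℤ) :
    lexpect n t g A = ∑' k, jumpExpect n k t g A := by
  simp only [lexpect, jumpExpect, transProb]
  rw [ENNReal.tsum_comm]
  simp_rw [ENNReal.tsum_mul_right]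

lemma measurable_lexpect (n : ℕ) (g : Finset ℤ → ℝ≥0∞) (A : Finset ℤ) :
    Measurable fun t => lexpect n t g A := by
  simp_rw [lexpect_eq_tsum]
  exact Measurable.tsum fun k => measurable_jumpExpect n k g A

lemma lexpect_le (n : ℕ) (g : Finset ℤ → ℝ≥0∞) (K : ℝ≥0∞) (hg : ∀ A, g A ≤ K)
    (A : Finset ℤ) {t : ℝ} (ht : 0 ≤ t) : lexpect n t g A ≤ K := by
  rw [lexpect_eq_tsum, ENNReal.tsum_eq_iSup_nat]
  exact iSup_le fun m => sum_jumpExpect_le n m g K hg A ht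

lemma lexpect_eq (n : ℕ) (t : ℝ) (g : Finset ℤ → ℝ≥0∞) (A : Finset ℤ) :
    lexpect n t g A = ENNReal.ofReal (Real.exp (-((active n A).card : ℝ) * t)) * g A +
      ∫⁻ s in Set.Ioc 0 t, ENNReal.ofReal (Real.exp (-((active n A).card : ℝ) * s)) *
        ∑ i ∈ active n A, lexpect n (t - s) g (topple i A) := by
  rw [lexpect_eq_tsum, tsum_eq_zero_add' ENNReal.summable, jumpExpect_zero]
  congr 1
  simp_rw [jumpExpect_succ, lexpect_eq_tsum]
  rw [← lintegral_tsum]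
  · refine lintegral_congr fun s => ?_
    rw [ENNReal.tsum_mul_left, Summable.tsum_finsetSum fun i _ => ENNReal.summable]
  · intro k
    apply Measurable.aemeasurable
    apply Measurable.mul (by fun_prop)
    refine Finset.measurable_sum _ fun i _ => ?_
    exact (measurable_jumpExpect n k g (topple i A)).comp (measurable_const.sub measurable_id)

/-- The substitution `r = t - s` moves the dependence on `t` out of the integrand, so that the
formula can be differentiated. The truncation `max r 0` makes the integrand meaningful at negative
times, where the a priori bound is not available. -/
lemma toReal_lexpect_eq (n : ℕ) (g : Finset ℤ → ℝ≥0∞) (K : ℝ≥0) (hg : ∀ A, g A ≤ K)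
    (A : Finset ℤ) {t : ℝ} (ht : 0 ≤ t) :
    (lexpect n t g A).toReal = Real.exp (-((active n A).card : ℝ) * t) * ((g A).toReal +
      ∫ r in (0 : ℝ)..t, Real.exp ((active n A).card * r) *
        ∑ i ∈ active n A, (lexpect n (max r 0) g (topple i A)).toReal) := by
  set q : ℝ := ((active n A).card : ℝ) with hq
  have hle : ∀ B r, 0 ≤ r → lexpect n r g B ≤ K := fun B r hr => lexpect_le n g K hg B hr
  have hfin : ∀ B r, 0 ≤ r → lexpect n r g B ≠ ∞ := fun B r hr =>
    ((hle B r hr).trans_lt ENNReal.coe_lt_top).ne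
  have hint : ∫⁻ s in Set.Ioc 0 t, ENNReal.ofReal (Real.exp (-q * s)) *
        ∑ i ∈ active n A, lexpect n (t - s) g (topple i A) =
      ∫⁻ s in Set.Ioc 0 t, ENNReal.ofReal (Real.exp (-q * s) *
        ∑ i ∈ active n A, (lexpect n (max (t - s) 0) g (topple i A)).toReal) := by
    refine setLIntegral_congr_fun measurableSet_Ioc fun s hs => ?_
    have hs' : 0 ≤ t - s := sub_nonneg.2 hs.2
    rw [ENNReal.ofReal_mul (Real.exp_pos _).le,
      ENNReal.ofReal_sum_of_nonneg fun i _ => ENNReal.toReal_nonneg, max_eq_left hs']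
    congr 1
    exact Finset.sum_congr rfl fun i _ => (ENNReal.ofReal_toReal (hfin _ _ hs')).symm
  have hmeas : Measurable fun r : ℝ =>
      ∑ i ∈ active n A, (lexpect n (max r 0) g (topple i A)).toReal := by
    refine Finset.measurable_sum _ fun i _ => Measurable.ennreal_toReal ?_
    exact (measurable_lexpect n g (topple i A)).comp (measurable_id.max measurable_const)
  have hgA : g A ≠ ∞ := ((hg A).trans_lt ENNReal.coe_lt_top).ne
  have hfin1 : ∫⁻ s in Set.Ioc 0 t, ENNReal.ofReal (Real.exp (-q * s)) *
        ∑ i ∈ active n A, lexpect n (t - s) g (topple i A) ≠ ∞ := by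
    refine ne_top_of_le_ne_top (hfin A t ht) ?_
    conv_rhs => rw [lexpect_eq]
    exact le_add_self
  rw [lexpect_eq, ENNReal.toReal_add (ENNReal.mul_ne_top ENNReal.ofReal_ne_top hgA) hfin1,
    ENNReal.toReal_mul, ENNReal.toReal_ofReal (Real.exp_pos _).le, mul_add, hint]
  congr 1
  rw [← integral_eq_lintegral_of_nonneg_ae, ← intervalIntegral.integral_of_le ht,
    ← intervalIntegral.integral_const_mul]
  · have := intervalIntegral.integral_comp_sub_left (a := 0) (b := t) (fun r => Real.exp (-q * t) *
        (Real.exp (q * r) *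
          ∑ i ∈ active n A, (lexpect n (max r 0) g (topple i A)).toReal)) t
    rw [sub_self, sub_zero] at this
    rw [← this]
    congr 1
    funext s
    rw [← mul_assoc, ← Real.exp_add]
    ring_nf
  · refine Eventually.of_forall fun s => mul_nonneg (Real.exp_pos _).le ?_
    exact Finset.sum_nonneg fun i _ => ENNReal.toReal_nonneg
  · apply Measurable.aestronglyMeasurable
    exact Measurable.mul (by fun_prop) (hmeas.comp (measurable_const.sub measurable_id))

/-- `u` is a bounded solution of the backward equation of the chain with generator `L⁽ⁿ⁾` and with
initial value `g`. -/
structure IsBackwardSolution (n : ℕ) (g : Finset ℤ → ℝ) (u : ℝ → Finset ℤ → ℝ) : Prop where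
  cont : ∀ A, ContinuousOn (fun t => u t A) (Set.Ici 0)
  deriv : ∀ A t, 0 < t →
    HasDerivAt (fun t => u t A) (∑ i ∈ active n A, (u t (topple i A) - u t A)) t
  bdd : ∃ K, ∀ A t, 0 ≤ t → |u t A| ≤ K
  init : ∀ A, u 0 A = g A

/-- Regularity is bootstrapped from the integral equation: a bounded measurable integrand makes the
solution continuous, so the integrand is continuous, and the solution is differentiable. -/
lemma isBackwardSolution_lexpect (n : ℕ) (g : Finset ℤ → ℝ≥0∞) (K : ℝ≥0) (hg : ∀ A, g A ≤ K) :
    IsBackwardSolution n (fun A => (g A).toReal) (fun t A => (lexpect n t g A).toReal) := by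
  have hbd : ∀ B r, 0 ≤ r → (lexpect n r g B).toReal ≤ K := fun B r hr =>
    ENNReal.toReal_le_coe_of_le_coe (lexpect_le n g K hg B hr)
  set b : Finset ℤ → ℝ → ℝ := fun A r =>
    ∑ i ∈ active n A, (lexpect n (max r 0) g (topple i A)).toReal with hb
  have hmeas : ∀ A, Measurable (b A) := by
    intro A
    refine Finset.measurable_sum _ fun i _ => Measurable.ennreal_toReal ?_
    exact (measurable_lexpect n g (topple i A)).comp (measurable_id.max measurable_const)
  have hb0 : ∀ A r, 0 ≤ b A r := fun A r => Finset.sum_nonneg fun i _ => ENNReal.toReal_nonneg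
  have hbK : ∀ A r, ‖b A r‖ ≤ (active n A).card * K := by
    intro A r
    rw [Real.norm_of_nonneg (hb0 A r), ← nsmul_eq_mul, ← Finset.sum_const]
    exact Finset.sum_le_sum fun i _ => hbd _ _ (le_max_right _ _)
  have hbint : ∀ A x y, IntervalIntegrable
      (fun r => Real.exp ((active n A).card * r) * b A r) volume x y := by
    intro A x y
    have h1 : IntervalIntegrable (b A) volume x y := by
      rw [intervalIntegrable_iff]
      exact Measure.integrableOn_of_bounded (M := (active n A).card * K) (by simp)
        (hmeas A).aestronglyMeasurable (Eventually.of_forall fun r => hbK A r)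
    exact h1.continuousOn_mul (Continuous.continuousOn (by fun_prop))
  set V : Finset ℤ → ℝ → ℝ := fun A t => Real.exp (-((active n A).card : ℝ) * t) *
    ((g A).toReal + ∫ r in (0 : ℝ)..t, Real.exp ((active n A).card * r) * b A r) with hV
  have hVcont : ∀ A, Continuous (V A) := by
    intro A
    have := intervalIntegral.continuous_primitive (hbint A) 0
    exact Continuous.mul (by fun_prop) (continuous_const.add this)
  have heq : ∀ A t, 0 ≤ t → (lexpect n t g A).toReal = V A t := fun A t ht =>
    toReal_lexpect_eq n g K hg A ht
  have hbcont : ∀ A, Continuous (b A) := by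
    intro A
    refine continuous_finsetSum _ fun i _ => ?_
    simp_rw [heq _ _ (le_max_right _ (0 : ℝ))]
    exact (hVcont _).comp (continuous_id.max continuous_const)
  have hVderiv : ∀ A t, HasDerivAt (V A) (b A t - (active n A).card * V A t) t := by
    intro A t
    have h1 : HasDerivAt (fun t => ∫ r in (0 : ℝ)..t, Real.exp ((active n A).card * r) * b A r)
        (Real.exp ((active n A).card * t) * b A t) t := by
      have hc : Continuous fun r => Real.exp ((active n A).card * r) * b A r :=
        Continuous.mul (by fun_prop) (hbcont A)
      exact (hc.integral_hasStrictDerivAt 0 t).hasDerivAt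
    have h2 := ((hasDerivAt_id t).const_mul (-((active n A).card : ℝ))).exp
    have h3 := h2.mul (h1.const_add (g A).toReal)
    refine h3.congr_deriv ?_
    simp only [hV, id, mul_one]
    have h4 : Real.exp (-((active n A).card : ℝ) * t) *
        (Real.exp ((active n A).card * t) * b A t) = b A t := by
      rw [← mul_assoc, ← Real.exp_add]
      simp
    rw [h4]
    ring
  refine ⟨fun A => ?_, fun A t ht => ?_, ⟨K, fun A t ht => ?_⟩, fun A => ?_⟩
  · exact (hVcont A).continuousOn.congr fun t ht => heq A t ht
  · have h1 : (fun t => (lexpect n t g A).toReal) =ᶠ[𝓝 t] V A := by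
      filter_upwards [lt_mem_nhds ht] with s hs using heq A s hs.le
    refine HasDerivAt.congr_of_eventuallyEq ?_ h1
    refine (hVderiv A t).congr_deriv ?_
    rw [Finset.sum_sub_distrib, Finset.sum_const, nsmul_eq_mul, heq A t ht.le]
    simp only [hb, max_eq_left ht.le]
  · rw [abs_of_nonneg ENNReal.toReal_nonneg]
    exact hbd A t ht
  · rw [heq A 0 le_rfl]
    simp [hV]

namespace IsBackwardSolution

variable {n : ℕ} {g g' : Finset ℤ → ℝ} {u v : ℝ → Finset ℤ → ℝ}

lemma congr (hu : IsBackwardSolution n g u) (h : ∀ A t, 0 ≤ t → v t A = u t A) :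
    IsBackwardSolution n g v := by
  refine ⟨fun A => (hu.cont A).congr fun t ht => h A t ht, fun A t ht => ?_, ?_, fun A => ?_⟩
  · have h1 : (fun t => v t A) =ᶠ[𝓝 t] fun t => u t A := by
      filter_upwards [lt_mem_nhds ht] with s hs using h A s hs.le
    simp_rw [h _ t ht.le]
    exact (hu.deriv A t ht).congr_of_eventuallyEq h1
  · obtain ⟨K, hK⟩ := hu.bdd
    exact ⟨K, fun A t ht => by rw [h A t ht]; exact hK A t ht⟩
  · rw [h A 0 le_rfl, hu.init]

lemma sub_const (hu : IsBackwardSolution n g u) (c : ℝ) :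
    IsBackwardSolution n (fun A => g A - c) (fun t A => u t A - c) := by
  refine ⟨fun A => (hu.cont A).sub continuousOn_const, fun A t ht => ?_, ?_, fun A => ?_⟩
  · refine ((hu.deriv A t ht).sub_const c).congr_deriv (Finset.sum_congr rfl fun i _ => ?_)
    ring
  · obtain ⟨K, hK⟩ := hu.bdd
    exact ⟨K + |c|, fun A t ht => (abs_sub _ _).trans (by linarith [hK A t ht])⟩
  · rw [hu.init]

lemma const (n : ℕ) (c : ℝ) : IsBackwardSolution n (fun _ => c) (fun _ _ => c) :=
  ⟨fun _ => continuousOn_const, fun A t _ => by simpa using hasDerivAt_const t c,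
    ⟨|c|, fun _ _ _ => le_rfl⟩, fun _ => rfl⟩

lemma shift (hu : IsBackwardSolution n g u) {s : ℝ} (hs : 0 ≤ s) :
    IsBackwardSolution n (u s) (fun t => u (t + s)) := by
  refine ⟨fun A => ?_, fun A t ht => ?_, ?_, fun A => by rw [zero_add]⟩
  · refine (hu.cont A).comp (Continuous.continuousOn (by fun_prop)) fun t ht => ?_
    exact add_nonneg ht hs
  · exact (hu.deriv A (t + s) (by linarith)).comp_add_const t s
  · obtain ⟨K, hK⟩ := hu.bdd
    exact ⟨K, fun A t ht => hK A _ (by linarith)⟩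

/-- The minimum principle for `v - u`, with the number of critical sites plus the window size
bounding the rates. -/
lemma le (hu : IsBackwardSolution n g u) (hv : IsBackwardSolution n g' v)
    (h : ∀ A, g A ≤ g' A) (A : Finset ℤ) {t : ℝ} (ht : 0 ≤ t) : u t A ≤ v t A := by
  obtain ⟨K, hK⟩ := hu.bdd
  obtain ⟨K', hK'⟩ := hv.bdd
  refine sub_nonneg.1 (nonneg_of_backward_supersolution (fun _ => True) (active n) topple
    (fun A => A.card + (Finset.Icc (-(n : ℤ)) n).card) (fun t A => v t A - u t A)
    (fun t A => ∑ i ∈ active n A, (v t (topple i A) - v t A) -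
      ∑ i ∈ active n A, (u t (topple i A) - u t A)) (K + K')
    (fun _ _ _ _ => trivial) (fun A => by positivity)
    (fun A => by exact_mod_cast Finset.card_union_le _ _) (fun A _ i _ => ?_)
    (fun A _ => (hv.cont A).sub (hu.cont A)) (fun A _ t ht => (hv.deriv A t ht).sub (hu.deriv A t ht))
    (fun A _ t ht => ?_) (fun A _ t ht => ?_) (fun A _ => ?_) A trivial t ht)
  · have : ((topple i A).card : ℝ) ≤ A.card + 1 := by exact_mod_cast card_topple_le i A
    linarith
  · rw [← Finset.sum_sub_distrib]
    exact (Finset.sum_congr rfl fun i _ => by ring).le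
  · have h1 := abs_le.1 (hK A t ht)
    have h2 := abs_le.1 (hK' A t ht)
    linarith
  · rw [hu.init, hv.init]
    exact sub_nonneg.2 (h A)

lemma unique (hu : IsBackwardSolution n g u) (hv : IsBackwardSolution n g v) (A : Finset ℤ)
    {t : ℝ} (ht : 0 ≤ t) : u t A = v t A :=
  le_antisymm (hu.le hv (fun _ => le_rfl) A ht) (hv.le hu (fun _ => le_rfl) A ht)

end IsBackwardSolution

/-- The chain does not explode. -/
lemma tsum_transProb (n : ℕ) {t : ℝ} (ht : 0 ≤ t) (A : Finset ℤ) :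
    ∑' B, transProb n t A B = 1 := by
  -- The total mass and the constant one are both bounded solutions with initial value one.
  have h1 := isBackwardSolution_lexpect n (fun _ => 1) 1 (fun _ => by simp)
  have h2 := h1.unique (v := fun _ _ => 1) (by simpa using IsBackwardSolution.const n 1) A ht
  have h3 : lexpect n t (fun _ => 1) A = ∑' B, transProb n t A B := by simp [lexpect]
  rw [← h3]
  have h4 : lexpect n t (fun _ => 1) A ≠ ∞ := by
    intro h
    simp [h] at h2
  rw [← ENNReal.ofReal_toReal h4, h2, ENNReal.ofReal_one]

lemma transProb_ne_top (n : ℕ) {t : ℝ} (ht : 0 ≤ t) (A B : Finset ℤ) :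
    transProb n t A B ≠ ∞ :=
  ENNReal.ne_top_of_tsum_ne_top (by rw [tsum_transProb n ht A]; simp) B

lemma hasSum_transProb (n : ℕ) {t : ℝ} (ht : 0 ≤ t) (A : Finset ℤ) :
    HasSum (fun B => (transProb n t A B).toReal) 1 := by
  have h1 : Summable fun B => (transProb n t A B).toReal :=
    ENNReal.summable_toReal (by rw [tsum_transProb n ht A]; simp)
  have h2 := ENNReal.tsum_toReal_eq (transProb_ne_top n ht A)
  rw [tsum_transProb n ht A, ENNReal.toReal_one] at h2
  exact h2 ▸ h1.hasSum

/-- The expectation of `g` at time `t` for the chain started at `A`. -/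
def expect (n : ℕ) (t : ℝ) (g : Finset ℤ → ℝ) (A : Finset ℤ) : ℝ :=
  ∑' B, (transProb n t A B).toReal * g B

section expect

variable {n : ℕ} {g g' : Finset ℤ → ℝ} {K K' : ℝ} {t : ℝ} {A : Finset ℤ}

lemma summable_expect (hg : ∀ A, |g A| ≤ K) (ht : 0 ≤ t) :
    Summable fun B => (transProb n t A B).toReal * g B := by
  refine Summable.of_norm_bounded ((hasSum_transProb n ht A).summable.mul_right K) fun B => ?_
  rw [Real.norm_eq_abs, abs_mul, abs_of_nonneg ENNReal.toReal_nonneg]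
  gcongr
  exact hg B

lemma expect_add (hg : ∀ A, |g A| ≤ K) (hg' : ∀ A, |g' A| ≤ K') (ht : 0 ≤ t) :
    expect n t (fun A => g A + g' A) A = expect n t g A + expect n t g' A := by
  simp only [expect, mul_add]
  exact (summable_expect hg ht).tsum_add (summable_expect hg' ht)

lemma expect_const (c : ℝ) (ht : 0 ≤ t) : expect n t (fun _ => c) A = c := by
  simp only [expect, tsum_mul_right, (hasSum_transProb n ht A).tsum_eq, one_mul]

lemma expect_mono (hg : ∀ A, |g A| ≤ K) (hg' : ∀ A, |g' A| ≤ K') (h : ∀ A, g A ≤ g' A)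
    (ht : 0 ≤ t) : expect n t g A ≤ expect n t g' A :=
  (summable_expect hg ht).tsum_le_tsum
    (fun B => mul_le_mul_of_nonneg_left (h B) ENNReal.toReal_nonneg) (summable_expect hg' ht)

lemma expect_sum {ι : Type*} (s : Finset ι) (f : ι → Finset ℤ → ℝ)
    (hf : ∀ i ∈ s, ∀ A, |f i A| ≤ K) (ht : 0 ≤ t) :
    expect n t (fun A => ∑ i ∈ s, f i A) A = ∑ i ∈ s, expect n t (f i) A := by
  simp only [expect, Finset.mul_sum]
  exact Summable.tsum_finsetSum fun i hi => summable_expect (hf i hi) ht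

lemma abs_expect_le (hg : ∀ A, |g A| ≤ K) (ht : 0 ≤ t) : |expect n t g A| ≤ K := by
  have hK : ∀ c : ℝ, ∀ A : Finset ℤ, |(fun _ : Finset ℤ => c) A| ≤ |c| := fun _ _ => le_rfl
  rw [abs_le]
  constructor
  · rw [← expect_const (n := n) (A := A) (-K) ht]
    exact expect_mono (hK _) hg (fun A => (abs_le.1 (hg A)).1) ht
  · rw [← expect_const (n := n) (A := A) K ht]
    exact expect_mono hg (hK _) (fun A => (abs_le.1 (hg A)).2) ht

lemma isBackwardSolution_expect (hg : ∀ A, |g A| ≤ K) :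
    IsBackwardSolution n g (fun t A => expect n t g A) := by
  have hK : 0 ≤ K := (abs_nonneg _).trans (hg ∅)
  -- Adding `K` makes `g` nonnegative, so the `ℝ≥0∞`-valued result applies.
  have h1 := (isBackwardSolution_lexpect n (fun A => ENNReal.ofReal (g A + K)) (2 * K).toNNReal
    (fun A => ENNReal.ofReal_le_ofReal (by linarith [(abs_le.1 (hg A)).2]))).sub_const K
  have hnn : ∀ A, 0 ≤ g A + K := fun A => by linarith [(abs_le.1 (hg A)).1]
  have h2 : (fun A => (ENNReal.ofReal (g A + K)).toReal - K) = g := by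
    funext A
    rw [ENNReal.toReal_ofReal (hnn A)]
    ring
  rw [h2] at h1
  refine h1.congr fun A t ht => ?_
  have h3 : expect n t g A = expect n t (fun A => g A + K) A - K := by
    rw [expect_add (K' := |K|) hg (fun _ => le_rfl) ht, expect_const K ht]
    ring
  rw [h3, lexpect, ENNReal.tsum_toReal_eq fun B =>
    ENNReal.mul_ne_top (transProb_ne_top n ht A B) ENNReal.ofReal_ne_top]
  simp_rw [ENNReal.toReal_mul, ENNReal.toReal_ofReal (hnn _)]
  rfl

lemma expect_zero (hg : ∀ A, |g A| ≤ K) : expect n 0 g A = g A :=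
  (isBackwardSolution_expect hg).init A

/-- The Chapman-Kolmogorov equation. -/
lemma expect_expect (hg : ∀ A, |g A| ≤ K) {s : ℝ} (hs : 0 ≤ s) (ht : 0 ≤ t) :
    expect n s (fun B => expect n t g B) A = expect n (s + t) g A :=
  -- As functions of `s`, both sides are bounded backward solutions that agree at `s = 0`.
  (isBackwardSolution_expect fun _ => abs_expect_le hg ht).unique
    ((isBackwardSolution_expect hg).shift ht) A hs

end expect

/-! ### Monotonicity -/

lemma sum_removeAt_sub (u : Finset ℤ → ℝ) {A A' : Finset ℤ} {x : ℤ} (hA : ∀ y ∈ A, y + x ∈ A') :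
    ∑ h ∈ A', (u (removeAt (h - x) A) - u A) = ∑ h ∈ A, (u (removeAt h A) - u A) := by
  have h1 : A.map (addRightEmbedding x) ⊆ A' := by
    intro y hy
    obtain ⟨z, hz, rfl⟩ := Finset.mem_map.1 hy
    exact hA z hz
  rw [← Finset.sum_subset h1, Finset.sum_map]
  · simp
  · intro h _ hh
    rw [removeAt_of_notMem, sub_self]
    intro hm
    exact hh (Finset.mem_map.2 ⟨h - x, hm, by simp⟩)

/-- Attractiveness: the chain with births in a larger window, started from a larger configuration
(both up to translation by `x`), dominates. -/
theorem expect_le_expect_of_shift {n n' : ℕ} {x : ℤ}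
    (hn : ∀ h ∈ Finset.Icc (-(n : ℤ)) n, h + x ∈ Finset.Icc (-(n' : ℤ)) n')
    {f g : Finset ℤ → ℝ} {K K' : ℝ} (hf : ∀ A, |f A| ≤ K) (hg : ∀ A, |g A| ≤ K')
    (hfg : ∀ A A', (∀ y ∈ A, y + x ∈ A') → f A ≤ g A') {A A' : Finset ℤ}
    (hA : ∀ y ∈ A, y + x ∈ A') {t : ℝ} (ht : 0 ≤ t) :
    expect n t f A ≤ expect n' t g A' := by
  have hu := isBackwardSolution_expect (n := n) hf
  have hv := isBackwardSolution_expect (n := n') hg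
  -- The minimum principle is applied to the coupled chain on ordered pairs. The left summand of the
  -- index type opens a common hole, the right one makes a common birth, suppressed in the smaller
  -- configuration outside its own window. All rates are controlled by the larger configuration.
  refine sub_nonneg.1 (nonneg_of_backward_supersolution
    (X := Finset ℤ × Finset ℤ) (ι := ℤ ⊕ ℤ) (fun p => ∀ y ∈ p.1, y + x ∈ p.2)
    (fun p => p.2.disjSum (Finset.Icc (-(n' : ℤ)) n'))
    (fun i p => Sum.elim (fun h => (removeAt (h - x) p.1, removeAt h p.2))
      (fun h => (if h - x ∈ Finset.Icc (-(n : ℤ)) n then insert (h - x) p.1 else p.1,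
        insert h p.2)) i)
    (fun p => p.2.card + (Finset.Icc (-(n' : ℤ)) n').card)
    (fun t p => expect n' t g p.2 - expect n t f p.1)
    (fun t p => ∑ i ∈ active n' p.2, (expect n' t g (topple i p.2) - expect n' t g p.2) -
      ∑ i ∈ active n p.1, (expect n t f (topple i p.1) - expect n t f p.1)) (K + K')
    ?_ (fun p => by positivity) (fun p => by rw [Finset.card_disjSum]; push_cast; rfl) ?_
    (fun p _ => (hv.cont p.2).sub (hu.cont p.1))
    (fun p _ t ht => (hv.deriv p.2 t ht).sub (hu.deriv p.1 t ht))
    ?_ (fun p _ t ht => ?_) (fun p hp => ?_) (A, A') hA t ht)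
  · rintro ⟨B, B'⟩ hB (h | h) -
    · exact removeAt_mono hB
    · intro y hy
      simp only [Sum.elim_inr] at hy ⊢
      rw [Finset.mem_insert]
      split_ifs at hy
      · rcases Finset.mem_insert.1 hy with h1 | h1
        · left; omega
        · exact Or.inr (hB y h1)
      · exact Or.inr (hB y hy)
  · rintro ⟨B, B'⟩ hB (h | h) -
    · have : ((removeAt h B').card : ℝ) ≤ B'.card + 1 := by exact_mod_cast card_removeAt_le h B'
      simp only [Sum.elim_inl]
      linarith
    · have : ((insert h B').card : ℝ) ≤ B'.card + 1 := by exact_mod_cast Finset.card_insert_le h B'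
      simp only [Sum.elim_inr]
      linarith
  · rintro ⟨B, B'⟩ hB s hs
    simp only at hB
    rw [Finset.sum_disjSum, sum_active, sum_active]
    simp only [Sum.elim_inl, Sum.elim_inr]
    rw [← sum_removeAt_sub _ hB]
    have h1 : ∑ h ∈ Finset.Icc (-(n : ℤ)) n, (expect n s f (insert h B) - expect n s f B) =
        ∑ h ∈ Finset.Icc (-(n' : ℤ)) n', (expect n s f
          (if h - x ∈ Finset.Icc (-(n : ℤ)) n then insert (h - x) B else B) - expect n s f B) := by
      have h2 : (Finset.Icc (-(n : ℤ)) n).map (addRightEmbedding x) ⊆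
          Finset.Icc (-(n' : ℤ)) n' := by
        intro y hy
        obtain ⟨z, hz, rfl⟩ := Finset.mem_map.1 hy
        exact hn z hz
      rw [← Finset.sum_subset h2, Finset.sum_map]
      · refine Finset.sum_congr rfl fun h hh => ?_
        simp only [addRightEmbedding_apply, add_sub_cancel_right, if_pos hh]
      · intro h _ hh
        rw [if_neg, sub_self]
        intro hm
        exact hh (Finset.mem_map.2 ⟨h - x, hm, by simp⟩)
    rw [h1]
    refine le_of_eq ?_
    simp only [Finset.sum_sub_distrib, Finset.sum_const]
    ring
  · have h1 := abs_le.1 (abs_expect_le (n := n) (A := p.1) hf ht)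
    have h2 := abs_le.1 (abs_expect_le (n := n') (A := p.2) hg ht)
    linarith
  · rw [expect_zero hf, expect_zero hg]
    exact sub_nonneg.2 (hfg _ _ hp)

lemma expect_le_expect {n n' : ℕ} (hn : n ≤ n') {f : Finset ℤ → ℝ} {K : ℝ} (hf : ∀ A, |f A| ≤ K)
    (hmono : Monotone f) {A A' : Finset ℤ} (hA : A ⊆ A') {t : ℝ} (ht : 0 ≤ t) :
    expect n t f A ≤ expect n' t f A' := by
  refine expect_le_expect_of_shift (x := 0) (fun h hh => ?_) hf hf
    (fun B B' hB => hmono fun y hy => by simpa using hB y hy) (fun y hy => by simpa using hA hy) ht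
  rw [Finset.mem_Icc] at hh ⊢
  omega

/-! ### Few holes in a long interval are filled quickly -/

/-- The indicator of the event that `x` is critical. -/
def isCritical (x : ℤ) (A : Finset ℤ) : ℝ := if x ∈ A then 1 else 0

lemma isCritical_nonneg (x : ℤ) (A : Finset ℤ) : 0 ≤ isCritical x A := by
  unfold isCritical
  split_ifs <;> norm_num

lemma isCritical_le_one (x : ℤ) (A : Finset ℤ) : isCritical x A ≤ 1 := by
  unfold isCritical
  split_ifs <;> norm_num

lemma abs_isCritical_le (x : ℤ) (A : Finset ℤ) : |isCritical x A| ≤ 1 := by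
  rw [abs_of_nonneg (isCritical_nonneg x A)]
  exact isCritical_le_one x A

lemma monotone_isCritical (x : ℤ) : Monotone (isCritical x) := by
  intro A B h
  unfold isCritical
  split_ifs with h1 h2 <;> norm_num
  exact h2 (h h1)

lemma expect_isCritical_mono {n n' : ℕ} (hn : n ≤ n') {x : ℤ} {A A' : Finset ℤ} (hA : A ⊆ A')
    {t : ℝ} (ht : 0 ≤ t) : expect n t (isCritical x) A ≤ expect n' t (isCritical x) A' :=
  expect_le_expect hn (abs_isCritical_le x) (monotone_isCritical x) hA ht

lemma expect_isCritical_nonneg (n : ℕ) (x : ℤ) (A : Finset ℤ) (t : ℝ) :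
    0 ≤ expect n t (isCritical x) A :=
  tsum_nonneg fun B => mul_nonneg ENNReal.toReal_nonneg (isCritical_nonneg x B)

/-- Births can only increase an increasing observable, so lower bounds need the avalanches alone. -/
lemma sum_removeAt_le_sum_active (n : ℕ) (x : ℤ) (A : Finset ℤ) {t : ℝ} (ht : 0 ≤ t) :
    ∑ h ∈ A, (expect n t (isCritical x) (removeAt h A) - expect n t (isCritical x) A) ≤
      ∑ i ∈ active n A, (expect n t (isCritical x) (topple i A) - expect n t (isCritical x) A) := by
  rw [sum_active n (fun A => expect n t (isCritical x) A)]
  refine le_add_of_nonneg_right (Finset.sum_nonneg fun h _ => sub_nonneg.2 ?_)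
  exact expect_isCritical_mono le_rfl (Finset.subset_insert h A) ht

lemma card_le_card_removeAt (h : ℤ) (A : Finset ℤ) : A.card ≤ (removeAt h A).card := by
  by_cases hh : h ∈ A
  · rw [removeAt, if_pos hh]
    refine le_trans ?_ (Finset.card_le_card (Finset.subset_insert _ _))
    rw [Finset.card_insert_of_notMem fun h' => kMinus_notMem h A (Finset.mem_of_mem_erase h'),
      Finset.card_erase_add_one hh]
  · rw [removeAt_of_notMem hh]

lemma removeAt_eq {A : Finset ℤ} {h a b : ℤ} (hh : h ∈ A) (hah : a < h) (hhb : h < b) (ha : a ∉ A)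
    (hb : b ∉ A) (hab : ∀ z, a < z → z < b → z ∈ A) :
    removeAt h A = insert b (insert a (A.erase h)) := by
  ext y
  simp only [mem_removeAt hh, Finset.mem_insert, Finset.mem_erase]
  constructor
  · rintro ⟨h1, h2 | ⟨h2, h3⟩⟩
    · exact Or.inr (Or.inr ⟨h1, h2⟩)
    · rcases lt_trichotomy y a with h4 | h4 | h4
      · exact absurd (h3 a h4 hah) ha
      · exact Or.inr (Or.inl h4)
      · rcases lt_trichotomy y b with h5 | h5 | h5
        · exact Or.inr (Or.inr ⟨h1, hab y h4 h5⟩)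
        · exact Or.inl h5
        · exact absurd (h2 b hhb h5) hb
  · rintro (rfl | rfl | ⟨h1, h2⟩)
    · exact ⟨by omega, Or.inr ⟨fun z _ _ => hab z (by omega) (by omega),
        fun z _ _ => hab z (by omega) (by omega)⟩⟩
    · exact ⟨by omega, Or.inr ⟨fun z _ _ => hab z (by omega) (by omega),
        fun z _ _ => hab z (by omega) (by omega)⟩⟩
    · exact ⟨h1, Or.inl h2⟩

/-- Intervals around `x` with at most one hole. -/
def HasAtMostOneHole (x : ℤ) (A : Finset ℤ) : Prop :=
  ∃ l r, l ≤ x ∧ x ≤ r ∧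
    (A = Finset.Icc l r ∨ ∃ g, l < g ∧ g < r ∧ A = (Finset.Icc l r).erase g)

/-- If there is a hole `g`, it is one end of the cluster of `h`. The avalanche fills it, extends the
interval by one site at the other end, and `h` becomes the only hole. -/
lemma HasAtMostOneHole.removeAt {x : ℤ} {A : Finset ℤ} (hA : HasAtMostOneHole x A) {h : ℤ}
    (hh : h ∈ A) : HasAtMostOneHole x (removeAt h A) := by
  obtain ⟨l, r, hl, hr, rfl | ⟨g, hlg, hgr, rfl⟩⟩ := hA
  · have hh' := Finset.mem_Icc.1 hh
    refine ⟨l - 1, r + 1, by omega, by omega, Or.inr ⟨h, by omega, by omega, ?_⟩⟩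
    rw [removeAt_eq (a := l - 1) (b := r + 1) hh (by omega) (by omega) (by simp) (by simp)
      (fun z _ _ => by rw [Finset.mem_Icc]; omega)]
    ext y
    simp only [Finset.mem_insert, Finset.mem_erase, Finset.mem_Icc]
    omega
  · have hh' := hh
    rw [Finset.mem_erase, Finset.mem_Icc] at hh'
    rcases lt_or_gt_of_ne hh'.1 with h1 | h1
    · refine ⟨l - 1, r, by omega, by omega, Or.inr ⟨h, by omega, by omega, ?_⟩⟩
      rw [removeAt_eq (a := l - 1) (b := g) hh (by omega) (by omega) (by simp) (by simp)
        (fun z _ _ => by rw [Finset.mem_erase, Finset.mem_Icc]; omega)]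
      ext y
      simp only [Finset.mem_insert, Finset.mem_erase, Finset.mem_Icc]
      omega
    · refine ⟨l, r + 1, by omega, by omega, Or.inr ⟨h, by omega, by omega, ?_⟩⟩
      rw [removeAt_eq (a := g) (b := r + 1) hh (by omega) (by omega) (by simp) (by simp)
        (fun z _ _ => by rw [Finset.mem_erase, Finset.mem_Icc]; omega)]
      ext y
      simp only [Finset.mem_insert, Finset.mem_erase, Finset.mem_Icc]
      omega

/-- If `x` is critical, only the avalanche with hole at `x` does harm, at rate one. If `x` is the
hole, every avalanche fills it. -/
lemma HasAtMostOneHole.sum_le {x : ℤ} {A : Finset ℤ} (hA : HasAtMostOneHole x A) :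
    ∑ h ∈ A, (isCritical x A - isCritical x (Sandpile.removeAt h A)) ≤
      1 - A.card * (1 - isCritical x A) := by
  by_cases hx : x ∈ A
  · have h1 : isCritical x A = 1 := if_pos hx
    rw [h1, sub_self, mul_zero, sub_zero]
    have h2 : ∀ h ∈ A, 1 - isCritical x (Sandpile.removeAt h A) ≤ if x = h then 1 else 0 := by
      intro h hh
      by_cases hxh : x = h
      · rw [if_pos hxh]
        linarith [isCritical_nonneg x (Sandpile.removeAt h A)]
      · have : x ∈ Sandpile.removeAt h A := (mem_removeAt hh).2 ⟨hxh, Or.inl hx⟩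
        rw [if_neg hxh, isCritical, if_pos this, sub_self]
    refine (Finset.sum_le_sum h2).trans ?_
    rw [Finset.sum_ite_eq, if_pos hx]
  · have h1 : isCritical x A = 0 := if_neg hx
    rw [h1]
    have h2 : ∀ h ∈ A, 0 - isCritical x (Sandpile.removeAt h A) = -1 := by
      intro h hh
      have : x ∈ Sandpile.removeAt h A := by
        obtain ⟨l, r, hl, hr, rfl | ⟨g, hlg, hgr, rfl⟩⟩ := hA
        · exact absurd (Finset.mem_Icc.2 ⟨hl, hr⟩) hx
        · have hxg : x = g := by
            by_contra hne
            exact hx (Finset.mem_erase.2 ⟨hne, Finset.mem_Icc.2 ⟨hl, hr⟩⟩)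
          rw [mem_removeAt hh]
          rw [Finset.mem_erase, Finset.mem_Icc] at hh
          refine ⟨by omega, Or.inr ⟨fun z _ _ => ?_, fun z _ _ => ?_⟩⟩ <;>
          · rw [Finset.mem_erase, Finset.mem_Icc]
            omega
      rw [isCritical, if_pos this, zero_sub]
    rw [Finset.sum_congr rfl h2, Finset.sum_const, nsmul_eq_mul]
    linarith

/-- The probability of a hole at `x` is compared with the solution of `p' = 1 - M p`. The comparison
uses only avalanches, which preserve both the one-hole shape and the lower bound `M` on the number
of critical sites. -/
lemma HasAtMostOneHole.expect_ge (n : ℕ) {x : ℤ} {M : ℕ} (hM : 0 < M) {A : Finset ℤ}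
    (hA : HasAtMostOneHole x A) (hAM : M ≤ A.card) {t : ℝ} (ht : 0 ≤ t) :
    1 - Real.exp (-(M : ℝ) * t) * (1 - isCritical x A) - (1 - Real.exp (-(M : ℝ) * t)) / M ≤
      expect n t (isCritical x) A := by
  have hu := isBackwardSolution_expect (n := n) (abs_isCritical_le x)
  have hM' : (0 : ℝ) < M := by exact_mod_cast hM
  have hexp : ∀ s, HasDerivAt (fun s : ℝ => Real.exp (-(M : ℝ) * s))
      (Real.exp (-(M : ℝ) * s) * (-(M : ℝ) * 1)) s := fun s =>
    ((hasDerivAt_id s).const_mul (-(M : ℝ))).exp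
  have key := nonneg_of_backward_supersolution
    (fun A => HasAtMostOneHole x A ∧ M ≤ A.card) (fun A => A) Sandpile.removeAt
    (fun A => (A.card : ℝ))
    (fun t A => expect n t (isCritical x) A - (1 - Real.exp (-(M : ℝ) * t) * (1 - isCritical x A) -
      (1 - Real.exp (-(M : ℝ) * t)) / M))
    (fun t A => ∑ i ∈ active n A, (expect n t (isCritical x) (topple i A) -
      expect n t (isCritical x) A) + Real.exp (-(M : ℝ) * t) * (1 - M * (1 - isCritical x A)))
    1 (fun A hA h hh => ⟨hA.1.removeAt hh, hA.2.trans (card_le_card_removeAt h A)⟩)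
    (fun A => by positivity) (fun A => le_rfl)
    (fun A hA h hh => by exact_mod_cast card_removeAt_le h A) (fun A hA => ?_)
    (fun A hA t ht => ?_) (fun A hA t ht => ?_) (fun A hA t ht => ?_) (fun A hA => ?_)
    A ⟨hA, hAM⟩ t ht
  · exact sub_nonneg.1 key
  · refine (hu.cont A).sub (Continuous.continuousOn ?_)
    fun_prop
  · have h1 := (((hexp t).mul_const (1 - isCritical x A)).const_sub 1).sub
      (((hexp t).const_sub 1).div_const (M : ℝ))
    refine ((hu.deriv A t ht).sub h1).congr_deriv ?_
    field_simp
    ring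
  · have h1 := sum_removeAt_le_sum_active n x A ht.le
    have h2 := hA.1.sum_le
    have h3 : (M : ℝ) * (1 - isCritical x A) ≤ A.card * (1 - isCritical x A) :=
      mul_le_mul_of_nonneg_right (by exact_mod_cast hA.2)
        (sub_nonneg.2 (isCritical_le_one x A))
    have h4 : ∑ h ∈ A, (isCritical x A - isCritical x (Sandpile.removeAt h A)) ≤
        1 - M * (1 - isCritical x A) := by linarith
    have h5 := mul_le_mul_of_nonneg_left h4 (Real.exp_pos (-(M : ℝ) * t)).le
    refine le_trans (le_of_eq ?_) (add_le_add h1 h5)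
    rw [Finset.mul_sum, ← Finset.sum_add_distrib]
    refine Finset.sum_congr rfl fun h _ => ?_
    ring
  · have h1 := expect_isCritical_nonneg n x A t
    have h2 : 0 ≤ Real.exp (-(M : ℝ) * t) * (1 - isCritical x A) :=
      mul_nonneg (Real.exp_pos _).le (sub_nonneg.2 (isCritical_le_one x A))
    have h3 : 0 ≤ (1 - Real.exp (-(M : ℝ) * t)) / M := by
      refine div_nonneg (sub_nonneg.2 (Real.exp_le_one_iff.2 ?_)) hM'.le
      nlinarith
    linarith
  · rw [expect_zero (abs_isCritical_le x)]
    simp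

/-- Grönwall with integrating factor `exp (M r)`: `p` relaxes towards `a` at rate at least `M`. -/
lemma le_of_deriv_le_mul_sub {p p' : ℝ → ℝ} {M a s t : ℝ}
    (hp : ∀ r, s ≤ r → HasDerivAt p (p' r) r) (hp' : ∀ r, s ≤ r → p' r ≤ M * (a - p r))
    (ha : 0 ≤ a) (hs : p s ≤ 1) (hst : s ≤ t) : p t ≤ a + Real.exp (-(M * (t - s))) := by
  have hder : ∀ r, s ≤ r → HasDerivAt (fun r => Real.exp (M * r) * (p r - a))
      (Real.exp (M * r) * (M * 1) * (p r - a) + Real.exp (M * r) * p' r) r := fun r hr =>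
    (((hasDerivAt_id r).const_mul M).exp).mul ((hp r hr).sub_const a)
  have hanti : AntitoneOn (fun r => Real.exp (M * r) * (p r - a)) (Set.Ici s) := by
    apply antitoneOn_of_deriv_nonpos (convex_Ici s)
    · exact fun r hr => (hder r hr).continuousAt.continuousWithinAt
    · exact fun r hr => (hder r (interior_subset hr)).differentiableAt.differentiableWithinAt
    · intro r hr
      have hr' : s ≤ r := interior_subset hr
      rw [(hder r hr').deriv]
      have h1 := mul_le_mul_of_nonneg_left (hp' r hr') (Real.exp_pos (M * r)).le
      nlinarith
  have h1 := hanti (Set.mem_Ici.2 le_rfl) (Set.mem_Ici.2 hst) hst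
  simp only at h1
  have h2 : Real.exp (M * s) * (p s - a) ≤ Real.exp (M * t) * Real.exp (-(M * (t - s))) := by
    rw [← Real.exp_add]
    ring_nf
    nlinarith [Real.exp_pos (M * s)]
  have h3 := le_of_mul_le_mul_left (h1.trans h2) (Real.exp_pos (M * t))
  linarith

/-- If all but finitely many sites of a long interval are critical, then `x` becomes critical almost
immediately. -/
theorem exists_expect_ge (n : ℕ) (x : ℤ) (F : Finset ℤ) :
    ∀ ε : ℝ, 0 < ε → ∀ δ : ℝ, 0 < δ → ∃ m : ℕ, ∀ t, δ ≤ t →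
      1 - ε ≤ expect n t (isCritical x) (Finset.Icc (-(m : ℤ)) m \ F) := by
  induction F using Finset.strongInduction with
  | H F ih =>
  intro ε hε δ hδ
  rcases F.eq_empty_or_nonempty with rfl | hF
  · obtain ⟨m, hm⟩ := exists_nat_gt (1 / ε + x.natAbs)
    refine ⟨m, fun t ht => ?_⟩
    rw [Finset.sdiff_empty]
    have hxm : (x.natAbs : ℝ) < m := by
      have : 0 < 1 / ε := by positivity
      linarith
    have hxm' : x.natAbs < m := by exact_mod_cast hxm
    have h1 : HasAtMostOneHole x (Finset.Icc (-(m : ℤ)) m) :=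
      ⟨-m, m, by omega, by omega, Or.inl rfl⟩
    have h2 := h1.expect_ge n (M := m) (by omega) (by rw [Int.card_Icc]; omega) (hδ.le.trans ht)
    refine le_trans ?_ h2
    have h3 : isCritical x (Finset.Icc (-(m : ℤ)) m) = 1 :=
      if_pos (Finset.mem_Icc.2 ⟨by omega, by omega⟩)
    have hm0 : (0 : ℝ) < m := by
      have : (0 : ℝ) ≤ x.natAbs := by positivity
      linarith
    have h4 : (1 - Real.exp (-(m : ℝ) * t)) / m ≤ ε := by
      rw [div_le_iff₀ hm0]
      have h5 : 1 / ε < m := by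
        have : (0 : ℝ) ≤ x.natAbs := by positivity
        linarith
      rw [div_lt_iff₀ hε] at h5
      linarith [Real.exp_pos (-(m : ℝ) * t)]
    rw [h3]
    linarith
  · obtain ⟨m₁, hm₁⟩ := ih _ (Finset.erase_ssubset (F.min'_mem hF)) (ε / 3) (by positivity)
      (δ / 2) (by positivity)
    obtain ⟨m₂, hm₂⟩ := ih _ (Finset.erase_ssubset (F.max'_mem hF)) (ε / 3) (by positivity)
      (δ / 2) (by positivity)
    set k : ℕ := max (max m₁ m₂) (F.sup Int.natAbs) with hk
    have hk1 : m₁ ≤ k := (le_max_left _ _).trans (le_max_left _ _)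
    have hk2 : m₂ ≤ k := (le_max_right _ _).trans (le_max_left _ _)
    have hkF : ∀ y ∈ F, y.natAbs ≤ k := fun y hy =>
      (Finset.le_sup (f := Int.natAbs) hy).trans (le_max_right _ _)
    -- Chosen so that `(2k + 1) / M + (2 / δ) / M ≤ 2ε / 3` for `M = A.card`. The first term
    -- accounts for new holes within distance `k`, the second for the relaxation error. The summands
    -- `k + F.card` ensure `k < m ≤ A.card`.
    obtain ⟨m, hm⟩ := exists_nat_gt (((2 * k + 1 : ℕ) + 2 / δ) * (3 / (2 * ε)) + k + F.card)
    have hpos : 0 < ((2 * k + 1 : ℕ) + 2 / δ) * (3 / (2 * ε)) := by positivity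
    have hmk : k + F.card < m := by
      have : ((k + F.card : ℕ) : ℝ) < m := by push_cast; linarith
      exact_mod_cast this
    refine ⟨m, fun t ht => ?_⟩
    set A := Finset.Icc (-(m : ℤ)) m \ F with hA
    have hcard : m ≤ A.card := by
      have := Finset.le_card_sdiff F (Finset.Icc (-(m : ℤ)) m)
      rw [Int.card_Icc, ← hA] at this
      omega
    have hM : ((2 * k + 1 : ℕ) + 2 / δ) * (3 / (2 * ε)) ≤ (A.card : ℝ) := by
      have : (m : ℝ) ≤ A.card := by exact_mod_cast hcard
      have h1 : (0 : ℝ) ≤ k := by positivity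
      have h2 : (0 : ℝ) ≤ F.card := by positivity
      linarith
    have hM0 : (0 : ℝ) < A.card := hpos.trans_le hM
    have hu := isBackwardSolution_expect (n := n) (abs_isCritical_le x)
    -- A new hole left of `[-k, k]` has only critical sites between itself and the leftmost hole of
    -- `F`, so that hole is filled. The result contains the interval of radius `m₁` with one hole
    -- fewer. The right side is symmetric.
    have hout : ∀ s, δ / 2 ≤ s → ∀ h ∈ A, k < h.natAbs →
        1 - ε / 3 ≤ expect n s (isCritical x) (removeAt h A) := by
      intro s hs h hh hkh
      have hs0 : 0 ≤ s := by linarith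
      have hmin := hkF _ (F.min'_mem hF)
      have hmax := hkF _ (F.max'_mem hF)
      have hhm := (Finset.mem_sdiff.1 hh).1
      rw [Finset.mem_Icc] at hhm
      rcases lt_or_ge h 0 with h0 | h0
      · refine (hm₁ s hs).trans (expect_isCritical_mono le_rfl (fun y hy => ?_) hs0)
        rw [Finset.mem_sdiff, Finset.mem_Icc, Finset.mem_erase] at hy
        rw [mem_removeAt hh]
        refine ⟨by omega, ?_⟩
        by_cases hyF : y = F.min' hF
        · refine Or.inr ⟨fun z hz hz' => ?_, fun z hz hz' => by omega⟩
          rw [hA, Finset.mem_sdiff, Finset.mem_Icc]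
          refine ⟨by omega, fun hzF => ?_⟩
          have := F.min'_le z hzF
          omega
        · refine Or.inl (Finset.mem_sdiff.2 ⟨Finset.mem_Icc.2 (by omega), fun h' => ?_⟩)
          exact hy.2 ⟨hyF, h'⟩
      · refine (hm₂ s hs).trans (expect_isCritical_mono le_rfl (fun y hy => ?_) hs0)
        rw [Finset.mem_sdiff, Finset.mem_Icc, Finset.mem_erase] at hy
        rw [mem_removeAt hh]
        refine ⟨by omega, ?_⟩
        by_cases hyF : y = F.max' hF
        · refine Or.inr ⟨fun z hz hz' => by omega, fun z hz hz' => ?_⟩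
          rw [hA, Finset.mem_sdiff, Finset.mem_Icc]
          refine ⟨by omega, fun hzF => ?_⟩
          have := F.le_max' z hzF
          omega
        · refine Or.inl (Finset.mem_sdiff.2 ⟨Finset.mem_Icc.2 (by omega), fun h' => ?_⟩)
          exact hy.2 ⟨hyF, h'⟩
    have hsum : ∀ s, δ / 2 ≤ s →
        ∑ h ∈ A, (1 - expect n s (isCritical x) (removeAt h A)) ≤
          A.card * (ε / 3) + (2 * k + 1 : ℕ) := by
      intro s hs
      have hs0 : 0 ≤ s := by linarith
      have h1 : ∀ h ∈ A, 1 - expect n s (isCritical x) (removeAt h A) ≤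
          ε / 3 + if h ∈ Finset.Icc (-(k : ℤ)) k then 1 else 0 := by
        intro h hh
        split_ifs with hhk
        · linarith [expect_isCritical_nonneg n x (removeAt h A) s]
        · have := hout s hs h hh (by rw [Finset.mem_Icc] at hhk; omega)
          linarith
      refine (Finset.sum_le_sum h1).trans ?_
      rw [Finset.sum_add_distrib, Finset.sum_const, nsmul_eq_mul, Finset.sum_boole]
      gcongr
      have h2 : (A.filter fun h => h ∈ Finset.Icc (-(k : ℤ)) k).card ≤
          (Finset.Icc (-(k : ℤ)) k).card :=
        Finset.card_le_card fun y hy => (Finset.mem_filter.1 hy).2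
      rw [Int.card_Icc] at h2
      omega
    -- The hole probability at `x` satisfies `p' ≤ M (a - p)` from time `δ / 2` on.
    have hfinal := le_of_deriv_le_mul_sub (p := fun s => 1 - expect n s (isCritical x) A)
      (p' := fun s => -∑ i ∈ active n A, (expect n s (isCritical x) (topple i A) -
        expect n s (isCritical x) A)) (M := A.card) (a := ε / 3 + (2 * k + 1 : ℕ) / A.card)
      (s := δ / 2) (t := t) (fun s hs => (hu.deriv A s (by linarith)).const_sub 1)
      (fun s hs => ?_) (by positivity)
      (by linarith [expect_isCritical_nonneg n x A (δ / 2)]) (by linarith)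
    · have h1 : Real.exp (-((A.card : ℝ) * (t - δ / 2))) ≤ 2 / δ / A.card := by
        have h2 : (A.card : ℝ) * (δ / 2) ≤ Real.exp ((A.card : ℝ) * (t - δ / 2)) := by
          refine le_trans ?_ (Real.add_one_le_exp _)
          have : (A.card : ℝ) * (δ / 2) ≤ (A.card : ℝ) * (t - δ / 2) := by
            gcongr
            linarith
          linarith
        rw [Real.exp_neg]
        calc (Real.exp ((A.card : ℝ) * (t - δ / 2)))⁻¹ ≤ ((A.card : ℝ) * (δ / 2))⁻¹ := by
              gcongr
          _ = 2 / δ / A.card := by field_simp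
      have h3 : ((2 * k + 1 : ℕ) : ℝ) / A.card + 2 / δ / A.card ≤ 2 * ε / 3 := by
        rw [← add_div, div_le_iff₀ hM0]
        calc ((2 * k + 1 : ℕ) : ℝ) + 2 / δ
            = 2 * ε / 3 * ((((2 * k + 1 : ℕ) : ℝ) + 2 / δ) * (3 / (2 * ε))) := by field_simp
          _ ≤ _ := by gcongr
      linarith
    · have h1 := sum_removeAt_le_sum_active n x A (t := s) (by linarith)
      have h2 := hsum s hs
      have h3 : (A.card : ℝ) * (ε / 3 + (2 * k + 1 : ℕ) / A.card -
          (1 - expect n s (isCritical x) A)) = A.card * (ε / 3) + (2 * k + 1 : ℕ) -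
          A.card * (1 - expect n s (isCritical x) A) := by
        field_simp
      rw [h3]
      rw [Finset.sum_sub_distrib, Finset.sum_const, nsmul_eq_mul] at h1 h2
      linarith

/-! ### Growth of the number of critical sites -/

/-- The number of critical sites grows at most exponentially. -/
theorem sum_expect_isCritical_le (n : ℕ) (s : Finset ℤ) {t : ℝ} (ht : 0 ≤ t) :
    ∑ x ∈ s, expect n t (isCritical x) ∅ ≤ (2 * n + 1) * (Real.exp t - 1) := by
  set f : Finset ℤ → ℝ := fun A => ∑ x ∈ s, isCritical x A with hf
  have hfb : ∀ A, |f A| ≤ s.card := by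
    intro A
    rw [abs_of_nonneg (Finset.sum_nonneg fun x _ => isCritical_nonneg x A)]
    refine (Finset.sum_le_sum fun x _ => isCritical_le_one x A).trans ?_
    simp
  have hfc : ∀ A, f A ≤ A.card := by
    intro A
    simp only [hf, isCritical]
    rw [Finset.sum_boole]
    exact_mod_cast Finset.card_le_card fun y hy => (Finset.mem_filter.1 hy).2
  have hu := isBackwardSolution_expect (n := n) hfb
  have hcard : ∀ A, ((active n A).card : ℝ) ≤ A.card + (2 * n + 1) := by
    intro A
    have h1 : (active n A).card ≤ A.card + _ := Finset.card_union_le _ _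
    rw [Int.card_Icc] at h1
    have h2 : (active n A).card ≤ A.card + (2 * n + 1) := by omega
    exact_mod_cast h2
  -- `exp t * (|A| + 2n + 1) - (2n + 1)` is a supersolution: at most `|A| + 2n + 1` sites are
  -- active, and each adds at most one critical site. Counting only within the finite set `s` keeps
  -- the observable bounded.
  have key := nonneg_of_backward_supersolution (fun _ => True) (active n) topple
    (fun A => A.card + (2 * n + 1))
    (fun t A => (Real.exp t * (A.card + (2 * n + 1)) - (2 * n + 1)) - expect n t f A)
    (fun t A => Real.exp t * (A.card + (2 * n + 1)) -
      ∑ i ∈ active n A, (expect n t f (topple i A) - expect n t f A)) s.card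
    (fun _ _ _ _ => trivial) (fun A => by positivity) hcard (fun A _ i _ => ?_)
    (fun A _ => ?_) (fun A _ t ht => ?_)
    (fun A _ t ht => ?_) (fun A _ t ht => ?_) (fun A _ => ?_) ∅ trivial t ht
  · rw [hf, expect_sum s isCritical (fun x _ => abs_isCritical_le x) ht] at key
    simp only [Finset.card_empty, Nat.cast_zero, zero_add] at key
    linarith
  · have : ((topple i A).card : ℝ) ≤ A.card + 1 := by exact_mod_cast card_topple_le i A
    linarith
  · exact ContinuousOn.sub (Continuous.continuousOn (by fun_prop)) (hu.cont A)
  · exact (((Real.hasDerivAt_exp t).mul_const _).sub_const _).sub (hu.deriv A t ht)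
  · have h1 : ∀ i ∈ active n A,
        (Real.exp t * ((topple i A).card + (2 * n + 1)) - (2 * n + 1)) -
          (Real.exp t * (A.card + (2 * n + 1)) - (2 * n + 1)) ≤ Real.exp t := by
      intro i _
      have : ((topple i A).card : ℝ) ≤ A.card + 1 := by exact_mod_cast card_topple_le i A
      nlinarith [Real.exp_pos t]
    have h2 := Finset.sum_le_sum h1
    rw [Finset.sum_const, nsmul_eq_mul] at h2
    have h3 : ((active n A).card : ℝ) * Real.exp t ≤ Real.exp t * (A.card + (2 * n + 1)) := by
      rw [mul_comm]
      exact mul_le_mul_of_nonneg_left (hcard A) (Real.exp_pos t).le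
    refine le_trans (le_of_eq ?_) (sub_le_sub_right (h2.trans h3) _)
    rw [← Finset.sum_sub_distrib]
    refine Finset.sum_congr rfl fun i _ => ?_
    ring
  · have h1 := (abs_le.1 (abs_expect_le (n := n) (A := A) hfb ht)).2
    have h2 : 1 * ((A.card : ℝ) + (2 * n + 1)) ≤ Real.exp t * (A.card + (2 * n + 1)) := by
      gcongr
      exact Real.one_le_exp ht
    have h3 : (0 : ℝ) ≤ A.card := by positivity
    linarith
  · rw [expect_zero hfb, Real.exp_zero]
    linarith [hfc A]

/-! ### Configurations and their critical sets -/

lemma eq_two_of_ne_one {h : Height} (hh : h ≠ one) : h = two := by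
  revert h
  decide

lemma one_ne_two : one ≠ two := by decide

lemma le_two (h : Height) : h ≤ two := by
  revert h
  decide

lemma eq_two_of_two_le {h : Height} (hh : two ≤ h) : h = two := le_antisymm (le_two h) hh

lemma one_le (h : Height) : one ≤ h := by
  revert h
  decide

lemma ofCritical_mono : Monotone ofCritical := by
  intro A B h x
  unfold ofCritical
  split_ifs with h1 h2
  · exact le_rfl
  · exact absurd (h h1) h2
  · exact one_le _
  · exact le_rfl

lemma ofCritical_eq_two {A : Finset ℤ} {x : ℤ} : ofCritical A x = two ↔ x ∈ A := by
  unfold ofCritical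
  split_ifs with h
  · simp [h]
  · simp [h, one_ne_two]

lemma mem_critical {m : ℕ} {η : Config} {x : ℤ} :
    x ∈ critical m η ↔ (-(m : ℤ) ≤ x ∧ x ≤ m) ∧ η x = two := by
  rw [critical, Finset.mem_filter, Finset.mem_Icc]

lemma critical_mono {m m' : ℕ} (hm : m ≤ m') {η η' : Config} (h : η ≤ η') :
    critical m η ⊆ critical m' η' := by
  intro x hx
  rw [mem_critical] at hx ⊢
  exact ⟨by omega, eq_two_of_two_le (hx.2 ▸ h x)⟩

lemma critical_ofCritical_subset (m : ℕ) (A : Finset ℤ) : critical m (ofCritical A) ⊆ A :=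
  fun _ hx => ofCritical_eq_two.1 (mem_critical.1 hx).2

lemma eventually_critical_ofCritical (A : Finset ℤ) :
    ∀ᶠ m : ℕ in atTop, critical m (ofCritical A) = A := by
  filter_upwards [eventually_ge_atTop (A.sup Int.natAbs)] with m hm
  ext x
  rw [mem_critical, ofCritical_eq_two]
  refine ⟨fun h => h.2, fun h => ⟨?_, h⟩⟩
  have := (Finset.le_sup (f := Int.natAbs) h).trans hm
  omega

lemma tendsto_ofCritical_critical (η : Config) :
    Tendsto (fun m : ℕ => ofCritical (critical m η)) atTop (𝓝 η) := by
  rw [tendsto_pi_nhds]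
  intro x
  apply tendsto_const_nhds.congr'
  filter_upwards [eventually_ge_atTop x.natAbs] with m hm
  by_cases hx : η x = two
  · rw [hx, eq_comm, ofCritical_eq_two, mem_critical]
    exact ⟨by omega, hx⟩
  · have h1 : x ∉ critical m η := fun h => hx (mem_critical.1 h).2
    rw [ofCritical, if_neg h1]
    by_contra h
    exact hx (eq_two_of_ne_one h)

lemma isLocallyConstant_critical (m : ℕ) : IsLocallyConstant (critical m) := by
  rw [IsLocallyConstant.iff_eventually_eq]
  intro η
  have h1 : ∀ x ∈ Finset.Icc (-(m : ℤ)) m, ∀ᶠ η' : Config in 𝓝 η, η' x = η x := fun x _ =>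
    IsOpen.mem_nhds (s := {η' : Config | η' x = η x})
      ((isOpen_discrete {η x}).preimage (by fun_prop : Continuous fun ξ : Config => ξ x)) rfl
  filter_upwards [(Filter.eventually_all_finset _).2 h1] with η' h
  exact Finset.filter_congr fun x hx => by rw [h x hx]

/-! ### Cylinder events -/

/-- The event that all sites of `C` are critical. -/
def allCritical (C : Finset ℤ) : Set Config := {ξ | ∀ x ∈ C, ξ x = two}

/-- The indicator of `allCritical C`. -/
def allCriticalIndicator (C : Finset ℤ) : Config → ℝ := (allCritical C).indicator fun _ => 1

lemma isClopen_allCritical (C : Finset ℤ) : IsClopen (allCritical C) := by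
  have : allCritical C = ⋂ x ∈ C, (fun ξ : Config => ξ x) ⁻¹' {two} := by
    ext ξ
    simp [allCritical]
  rw [this]
  exact isClopen_biInter_finset fun x _ => (isClopen_discrete _).preimage (continuous_apply x)

lemma measurableSet_allCritical (C : Finset ℤ) : MeasurableSet (allCritical C) :=
  (isClopen_allCritical C).isOpen.measurableSet

lemma continuous_allCriticalIndicator (C : Finset ℤ) : Continuous (allCriticalIndicator C) :=
  continuous_const.indicator fun a ha => by simp [(isClopen_allCritical C).frontier_eq] at ha

lemma monotone_allCriticalIndicator (C : Finset ℤ) : Monotone (allCriticalIndicator C) := by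
  intro ξ ξ' h
  by_cases h1 : ξ ∈ allCritical C
  · have h2 : ξ' ∈ allCritical C := fun x hx => eq_two_of_two_le (h1 x hx ▸ h x)
    rw [allCriticalIndicator, Set.indicator_of_mem h1, Set.indicator_of_mem h2]
  · rw [allCriticalIndicator, Set.indicator_of_notMem h1]
    exact Set.indicator_nonneg (fun _ _ => zero_le_one) _

lemma integral_allCriticalIndicator (μ : Measure Config) (C : Finset ℤ) :
    ∫ ξ, allCriticalIndicator C ξ ∂μ = μ.real (allCritical C) :=
  integral_indicator_one (measurableSet_allCritical C)

lemma isPiSystem_allCritical : IsPiSystem (Set.range allCritical) := by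
  rintro _ ⟨C, rfl⟩ _ ⟨C', rfl⟩ -
  refine ⟨C ∪ C', ?_⟩
  ext ξ
  simp only [allCritical, Finset.mem_union, Set.mem_ofPred_eq, Set.mem_inter_iff]
  exact ⟨fun h => ⟨fun x hx => h x (Or.inl hx), fun x hx => h x (Or.inr hx)⟩,
    fun h x hx => hx.elim (h.1 x) (h.2 x)⟩

lemma generateFrom_allCritical :
    (MeasurableSpace.pi : MeasurableSpace Config) =
      MeasurableSpace.generateFrom (Set.range allCritical) := by
  apply le_antisymm
  · refine iSup_le fun x => ?_
    rw [← measurable_iff_comap_le]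
    have h2 : MeasurableSet[MeasurableSpace.generateFrom (Set.range allCritical)]
        ((fun ξ : Config => ξ x) ⁻¹' {two}) := by
      apply MeasurableSpace.measurableSet_generateFrom
      refine ⟨{x}, ?_⟩
      ext ξ
      simp [allCritical]
    refine @measurable_to_countable' _ _ _ _ (MeasurableSpace.generateFrom (Set.range allCritical))
      _ fun h => ?_
    by_cases hh : h = two
    · rw [hh]
      exact h2
    · convert h2.compl using 1
      ext ξ
      simp only [Set.mem_preimage, Set.mem_singleton_iff, Set.mem_compl_iff]
      constructor
      · rintro rfl
        exact hh
      · intro h'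
        by_contra hne
        have h3 : ξ x = one := by
          by_contra h4
          exact h' (eq_two_of_ne_one h4)
        have h5 : h = one := by
          by_contra h4
          exact hh (eq_two_of_ne_one h4)
        exact hne (h3.trans h5.symm)
  · apply MeasurableSpace.generateFrom_le
    rintro _ ⟨C, rfl⟩
    exact measurableSet_allCritical C

/-- The increasing clopen events `allCritical C` form a generating π-system. Limits for continuous
increasing functions therefore determine the law. -/
lemma measure_ext_of_allCritical {μ ν : Measure Config} [IsProbabilityMeasure μ]
    [IsProbabilityMeasure ν] (h : ∀ C, μ.real (allCritical C) = ν.real (allCritical C)) :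
    μ = ν := by
  refine ext_of_generate_finite _ generateFrom_allCritical isPiSystem_allCritical ?_ (by simp)
  rintro _ ⟨C, rfl⟩
  exact (measureReal_eq_measureReal_iff).1 (h C)

lemma exists_abs_le {f : Config → ℝ} (hf : Continuous f) : ∃ K, ∀ ξ, |f ξ| ≤ K := by
  obtain ⟨K, hK⟩ := isCompact_univ.exists_bound_of_continuousOn (f := f) hf.continuousOn
  exact ⟨K, fun ξ => hK ξ (Set.mem_univ ξ)⟩

lemma integrable_of_continuous (μ : Measure Config) [IsProbabilityMeasure μ] {f : Config → ℝ}
    (hf : Continuous f) : Integrable f μ := by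
  obtain ⟨K, hK⟩ := exists_abs_le hf
  exact Integrable.of_bound hf.measurable.aestronglyMeasurable K (Eventually.of_forall hK)

/-! ### Laws of the approximating chains -/

lemma isProbabilityMeasure_chainLaw (n : ℕ) {t : ℝ} (ht : 0 ≤ t) (A : Finset ℤ) :
    IsProbabilityMeasure (chainLaw n t A) := by
  constructor
  rw [chainLaw, Measure.sum_apply _ MeasurableSet.univ]
  simpa using tsum_transProb n ht A

lemma integral_chainLaw (n : ℕ) {t : ℝ} (ht : 0 ≤ t) {f : Config → ℝ} (hf : Continuous f)
    (A : Finset ℤ) :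
    ∫ ξ, f ξ ∂(chainLaw n t A) = expect n t (fun B => f (ofCritical B)) A := by
  have := isProbabilityMeasure_chainLaw n ht A
  have hint := integrable_of_continuous (chainLaw n t A) hf
  rw [chainLaw] at hint ⊢
  rw [integral_sum_measure hint]
  simp [expect, integral_smul_measure, integral_dirac]

/-- The expectation `S_n(t) f(η')` for the restriction `η'` of `η` to `[-n, n]`. -/
def approx (n : ℕ) (t : ℝ) (f : Config → ℝ) (η : Config) : ℝ :=
  expect n t (fun B => f (ofCritical B)) (critical n η)

lemma continuous_approx (n : ℕ) (t : ℝ) (f : Config → ℝ) : Continuous (approx n t f) :=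
  ((isLocallyConstant_critical n).comp _).continuous

section approx

variable {t : ℝ} {f : Config → ℝ} {K : ℝ}

lemma abs_approx_le (n : ℕ) (ht : 0 ≤ t) (hK : ∀ ξ, |f ξ| ≤ K) (η : Config) :
    |approx n t f η| ≤ K :=
  abs_expect_le (fun _ => hK _) ht

lemma approx_mono (ht : 0 ≤ t) (hK : ∀ ξ, |f ξ| ≤ K) (hf : Monotone f) {n n' : ℕ} (hn : n ≤ n')
    {η η' : Config} (hη : η ≤ η') : approx n t f η ≤ approx n' t f η' :=
  expect_le_expect hn (fun _ => hK _) (hf.comp ofCritical_mono) (critical_mono hn hη) ht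

end approx

/-- For arrays increasing in both indices the iterated limit equals the diagonal one. Hence `approx`
may use one index for both the birth window and the restriction. -/
lemma exists_tendsto_of_monotone {a : ℕ → ℕ → ℝ} {K L : ℝ}
    (ha : ∀ n n' m m', n ≤ n' → m ≤ m' → a n m ≤ a n' m') (hK : ∀ n m, a n m ≤ K)
    (hL : Tendsto (fun n => a n n) atTop (𝓝 L)) :
    ∃ g : ℕ → ℝ, (∀ n, Tendsto (a n) atTop (𝓝 (g n))) ∧ Tendsto g atTop (𝓝 L) := by
  have hbdd : ∀ n, BddAbove (Set.range (a n)) := fun n =>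
    ⟨K, by rintro _ ⟨m, rfl⟩; exact hK n m⟩
  refine ⟨fun n => ⨆ m, a n m, fun n =>
    tendsto_atTop_ciSup (fun m m' h => ha n n m m' le_rfl h) (hbdd n), ?_⟩
  refine tendsto_of_tendsto_of_tendsto_of_le_of_le hL tendsto_const_nhds
    (fun n => le_ciSup (hbdd n) n) fun n => ciSup_le fun m => ?_
  have hmono : Monotone fun n => a n n := fun n n' h => ha n n' n n' h h
  exact (ha _ _ _ _ (le_max_left n m) (le_max_right n m)).trans (hmono.ge_of_tendsto hL (max n m))

/-- The laws of the approximating chains converge. -/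
theorem exists_limitLaw (t : ℝ≥0) (η : Config) :
    ∃ μ : ProbabilityMeasure Config, ∀ f : Config → ℝ, Continuous f → Monotone f →
      Tendsto (fun n => approx n t f η) atTop (𝓝 (∫ ξ, f ξ ∂(μ : Measure Config))) := by
  set ν : ℕ → ProbabilityMeasure Config := fun n =>
    ⟨chainLaw n t (critical n η), isProbabilityMeasure_chainLaw n t.2 _⟩ with hν
  -- An ultrafilter limit supplies the candidate law. For increasing `f` the sequence `approx n t f
  -- η` is monotone, so the ultrafilter limit is its limit along `atTop`.
  obtain ⟨μ, -, hμ⟩ := (isCompact_univ (X := ProbabilityMeasure Config)).ultrafilter_le_nhds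
    ((hyperfilter ℕ).map ν) (by simp)
  have hμ' : Tendsto ν (hyperfilter ℕ) (𝓝 μ) := hμ
  rw [ProbabilityMeasure.tendsto_iff_forall_integral_tendsto] at hμ'
  refine ⟨μ, fun f hf hmono => ?_⟩
  obtain ⟨K, hK⟩ := exists_abs_le hf
  have h1 : Tendsto (fun n => approx n t f η) (hyperfilter ℕ)
      (𝓝 (∫ ξ, f ξ ∂(μ : Measure Config))) := by
    refine (hμ' (BoundedContinuousFunction.mkOfCompact ⟨f, hf⟩)).congr fun n => ?_
    exact integral_chainLaw n t.2 hf _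
  have h2 := tendsto_atTop_ciSup (f := fun n => approx n t f η)
    (fun n n' hn => approx_mono t.2 hK hmono hn le_rfl)
    ⟨K, by rintro _ ⟨n, rfl⟩; exact (abs_le.1 (abs_approx_le n t.2 hK η)).2⟩
  have h3 := tendsto_nhds_unique h1 (h2.mono_left Nat.hyperfilter_le_atTop)
  rw [h3]
  exact h2

/-- The law of the sandpile process at time `t`. -/
def limitLaw (t : ℝ≥0) (η : Config) : Measure Config := (exists_limitLaw t η).choose

instance (t : ℝ≥0) (η : Config) : IsProbabilityMeasure (limitLaw t η) :=
  (exists_limitLaw t η).choose.2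

lemma tendsto_approx (t : ℝ≥0) (η : Config) {f : Config → ℝ} (hf : Continuous f)
    (hmono : Monotone f) :
    Tendsto (fun n => approx n t f η) atTop (𝓝 (∫ ξ, f ξ ∂(limitLaw t η))) :=
  (exists_limitLaw t η).choose_spec f hf hmono

lemma approx_le_integral (n : ℕ) (t : ℝ≥0) (η : Config) {f : Config → ℝ} (hf : Continuous f)
    (hmono : Monotone f) : approx n t f η ≤ ∫ ξ, f ξ ∂(limitLaw t η) := by
  obtain ⟨K, hK⟩ := exists_abs_le hf
  exact Monotone.ge_of_tendsto (fun n n' hn => approx_mono t.2 hK hmono hn le_rfl)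
    (tendsto_approx t η hf hmono) n

lemma measurable_limitLaw (t : ℝ≥0) : Measurable (limitLaw t) := by
  refine Measurable.measure_of_isPiSystem_of_isProbabilityMeasure generateFrom_allCritical
    isPiSystem_allCritical ?_
  rintro _ ⟨C, rfl⟩
  have h1 : Measurable fun η => (limitLaw t η).real (allCritical C) := by
    refine measurable_of_tendsto_metrizable
      (fun n => (continuous_approx n t (allCriticalIndicator C)).measurable) ?_
    rw [tendsto_pi_nhds]
    intro η
    rw [← integral_allCriticalIndicator]
    exact tendsto_approx t η (continuous_allCriticalIndicator C) (monotone_allCriticalIndicator C)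
  have h2 : (fun η => limitLaw t η (allCritical C)) =
      fun η => ENNReal.ofReal ((limitLaw t η).real (allCritical C)) := by
    funext η
    rw [ofReal_measureReal]
  rw [h2]
  exact h1.ennreal_ofReal

/-- The transition semigroup of the sandpile process. -/
def sandpileKernel (t : ℝ≥0) : Kernel Config Config := ⟨limitLaw t, measurable_limitLaw t⟩

instance (t : ℝ≥0) : IsMarkovKernel (sandpileKernel t) :=
  ⟨fun η => inferInstanceAs (IsProbabilityMeasure (limitLaw t η))⟩

lemma sandpileKernel_apply (t : ℝ≥0) (η : Config) : sandpileKernel t η = limitLaw t η := rfl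

lemma sandpileKernel_zero : sandpileKernel 0 = Kernel.id := by
  refine Kernel.ext fun η => ?_
  rw [sandpileKernel_apply, Kernel.id_apply]
  refine measure_ext_of_allCritical fun C => ?_
  rw [← integral_allCriticalIndicator, ← integral_allCriticalIndicator, integral_dirac]
  have hf := continuous_allCriticalIndicator C
  obtain ⟨K, hK⟩ := exists_abs_le hf
  refine tendsto_nhds_unique (tendsto_approx 0 η hf (monotone_allCriticalIndicator C)) ?_
  refine ((hf.tendsto η).comp (tendsto_ofCritical_critical η)).congr fun n => ?_
  exact (expect_zero fun _ => hK _).symm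

/-- One half of the semigroup property. The inner expectation is restricted to `[-k, k]`, which
makes it a continuous increasing function of the configuration; for each finite `B` this changes
nothing once `k` is large. -/
lemma expect_le_integral_approx (s t : ℝ≥0) {f : Config → ℝ} (hf : Continuous f)
    (hmono : Monotone f) (n : ℕ) (η : Config) {L : ℝ}
    (hL : ∀ k, ∫ ξ, approx k t f ξ ∂(limitLaw s η) ≤ L) : approx n (s + t) f η ≤ L := by
  obtain ⟨K, hK⟩ := exists_abs_le hf
  have h1 : Tendsto (fun k : ℕ => expect n s (fun B =>
      expect n t (fun B => f (ofCritical B)) (critical k (ofCritical B))) (critical n η)) atTop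
      (𝓝 (approx n (s + t) f η)) := by
    have h2 : approx n (s + t) f η = expect n s (fun B =>
        expect n t (fun B => f (ofCritical B)) B) (critical n η) :=
      (expect_expect (fun _ => hK _) s.2 t.2).symm
    rw [h2]
    refine tendsto_tsum_of_dominated_convergence
      (bound := fun B => (transProb n s (critical n η) B).toReal * K)
      ((hasSum_transProb n s.2 _).summable.mul_right K) (fun B => ?_)
      (Eventually.of_forall fun k B => ?_)
    · apply tendsto_const_nhds.congr'
      filter_upwards [eventually_critical_ofCritical B] with k hk
      rw [hk]
    · rw [Real.norm_eq_abs, abs_mul, abs_of_nonneg ENNReal.toReal_nonneg]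
      gcongr
      exact abs_expect_le (fun _ => hK _) t.2
  refine le_of_tendsto h1 ?_
  filter_upwards [eventually_ge_atTop n] with k hk
  refine le_trans ?_ ((approx_le_integral n s η (continuous_approx k t f)
    (fun ξ ξ' h => approx_mono t.2 hK hmono le_rfl h)).trans (hL k))
  refine expect_mono (fun _ => abs_expect_le (fun _ => hK _) t.2)
    (fun _ => abs_approx_le k t.2 hK _) (fun B => ?_) s.2
  exact expect_le_expect hk (fun _ => hK _) (hmono.comp ofCritical_mono) subset_rfl t.2

/-- The other half: for `j ≥ k`, restricting to `[-k, k]` and using the window `k` only lowers the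
inner expectation, so the Chapman-Kolmogorov equation of chain `j` gives an upper bound. -/
lemma integral_approx_le (s t : ℝ≥0) {f : Config → ℝ} (hf : Continuous f)
    (hmono : Monotone f) (k : ℕ) (η : Config) :
    ∫ ξ, approx k t f ξ ∂(limitLaw s η) ≤ ∫ ξ, f ξ ∂(limitLaw (s + t) η) := by
  obtain ⟨K, hK⟩ := exists_abs_le hf
  refine le_of_tendsto (tendsto_approx s η (continuous_approx k t f)
    (fun ξ ξ' h => approx_mono t.2 hK hmono le_rfl h)) ?_
  filter_upwards [eventually_ge_atTop k] with j hj
  refine le_trans ?_ (approx_le_integral j (s + t) η hf hmono)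
  have h2 : approx j ((s + t : ℝ≥0) : ℝ) f η = expect j s (fun B =>
      expect j t (fun B => f (ofCritical B)) B) (critical j η) :=
    (expect_expect (fun _ => hK _) s.2 t.2).symm
  rw [h2]
  refine expect_mono (fun _ => abs_approx_le k t.2 hK _)
    (fun _ => abs_expect_le (fun _ => hK _) t.2) (fun B => ?_) s.2
  exact expect_le_expect hj (fun _ => hK _) (hmono.comp ofCritical_mono)
    (critical_ofCritical_subset k B) t.2

lemma sandpileKernel_add (s t : ℝ≥0) :
    sandpileKernel (s + t) = sandpileKernel t ∘ₖ sandpileKernel s := by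
  refine Kernel.ext fun η => measure_ext_of_allCritical fun C => ?_
  have hf := continuous_allCriticalIndicator C
  have hmono := monotone_allCriticalIndicator C
  obtain ⟨K, hK⟩ := exists_abs_le hf
  have h1 : ((sandpileKernel t ∘ₖ sandpileKernel s) η).real (allCritical C) =
      ∫ ξ, (limitLaw t ξ).real (allCritical C) ∂(limitLaw s η) := by
    rw [measureReal_def, Kernel.comp_apply' _ _ _ (measurableSet_allCritical C)]
    simp only [measureReal_def]
    rw [integral_toReal]
    · rfl
    · exact ((sandpileKernel t).measurable_coe (measurableSet_allCritical C)).aemeasurable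
    · exact Eventually.of_forall fun ξ => measure_lt_top _ _
  have h2 : Tendsto (fun k => ∫ ξ, approx k t (allCriticalIndicator C) ξ ∂(limitLaw s η)) atTop
      (𝓝 (∫ ξ, (limitLaw t ξ).real (allCritical C) ∂(limitLaw s η))) := by
    refine tendsto_integral_of_dominated_convergence (fun _ => K)
      (fun k => (continuous_approx k t _).measurable.aestronglyMeasurable)
      (integrable_const K) (fun k => Eventually.of_forall fun ξ => abs_approx_le k t.2 hK ξ)
      (Eventually.of_forall fun ξ => ?_)
    rw [← integral_allCriticalIndicator]
    exact tendsto_approx t ξ hf hmono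
  rw [h1, sandpileKernel_apply, ← integral_allCriticalIndicator]
  apply le_antisymm
  · refine le_of_tendsto' (tendsto_approx (s + t) η hf hmono) fun n => ?_
    refine expect_le_integral_approx s t hf hmono n η fun k => Monotone.ge_of_tendsto ?_ h2 k
    intro k k' hk
    exact integral_mono (integrable_of_continuous _ (continuous_approx k t _))
      (integrable_of_continuous _ (continuous_approx k' t _))
      fun ξ => approx_mono t.2 hK hmono hk le_rfl
  · exact le_of_tendsto' h2 fun k => integral_approx_le s t hf hmono k η

theorem isSandpileSemigroup_sandpileKernel : IsSandpileSemigroup sandpileKernel where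
  isMarkovKernel t := inferInstance
  zero := sandpileKernel_zero
  add := sandpileKernel_add
  limit t f hf hmono η := by
    obtain ⟨K, hK⟩ := exists_abs_le hf
    have h1 : ∀ n m, semigroupApprox n t f (critical m η) =
        expect n t (fun B => f (ofCritical B)) (critical m η) := fun n m =>
      integral_chainLaw n t.2 hf _
    simp_rw [h1]
    refine exists_tendsto_of_monotone (K := K) (fun n n' m m' hn hm => ?_) (fun n m => ?_)
      (tendsto_approx t η hf hmono)
    · exact expect_le_expect hn (fun _ => hK _) (hmono.comp ofCritical_mono)
        (critical_mono hm le_rfl) t.2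
    · exact (abs_le.1 (abs_expect_le (fun _ => hK _) t.2)).2

/-- The limit along the approximating chains determines the semigroup. -/
theorem IsSandpileSemigroup.unique {P Q : ℝ≥0 → Kernel Config Config} (hP : IsSandpileSemigroup P)
    (hQ : IsSandpileSemigroup Q) : Q = P := by
  funext t
  refine Kernel.ext fun η => ?_
  have := hP.isMarkovKernel t
  have := hQ.isMarkovKernel t
  refine measure_ext_of_allCritical fun C => ?_
  obtain ⟨g, hg, hg'⟩ := hP.limit t _ (continuous_allCriticalIndicator C)
    (monotone_allCriticalIndicator C) η
  obtain ⟨h, hh, hh'⟩ := hQ.limit t _ (continuous_allCriticalIndicator C)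
    (monotone_allCriticalIndicator C) η
  have : g = h := funext fun n => tendsto_nhds_unique (hg n) (hh n)
  rw [← integral_allCriticalIndicator, ← integral_allCriticalIndicator]
  exact tendsto_nhds_unique hh' (this ▸ hg')

/-! ### Configurations with finitely many sites of height one -/

/-- The configuration in which all sites are critical. -/
def allTwo : Config := fun _ => two

lemma allCriticalIndicator_singleton (x : ℤ) (B : Finset ℤ) :
    allCriticalIndicator {x} (ofCritical B) = isCritical x B := by
  have h : ofCritical B ∈ allCritical {x} ↔ x ∈ B := by
    simp [allCritical, ofCritical_eq_two]
  by_cases hx : x ∈ B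
  · rw [allCriticalIndicator, Set.indicator_of_mem (h.2 hx), isCritical, if_pos hx]
  · rw [allCriticalIndicator, Set.indicator_of_notMem (h.not.2 hx), isCritical, if_neg hx]

lemma approx_singleton (n : ℕ) (t : ℝ) (x : ℤ) (η : Config) :
    approx n t (allCriticalIndicator {x}) η = expect n t (isCritical x) (critical n η) := by
  simp only [approx, allCriticalIndicator_singleton]

/-- Started from finitely many sites of height one, all sites are critical at any positive time. -/
theorem limitLaw_eq_dirac {η : Config} (hη : (ones η).Finite) {t : ℝ≥0} (ht : 0 < t) :
    limitLaw t η = Measure.dirac allTwo := by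
  have h1 : ∀ x : ℤ, (limitLaw t η).real (allCritical {x}) = 1 := by
    intro x
    refine le_antisymm measureReal_le_one (le_of_forall_pos_sub_le fun ε hε => ?_)
    -- The smallest birth window suffices, since avalanches fill the holes; monotonicity in the
    -- window then passes to chain `m`.
    obtain ⟨m, hm⟩ := exists_expect_ge 0 x hη.toFinset ε hε t ht
    have h2 : critical m η = Finset.Icc (-(m : ℤ)) m \ hη.toFinset := by
      ext y
      rw [mem_critical, Finset.mem_sdiff, Finset.mem_Icc, Set.Finite.mem_toFinset]
      refine and_congr_right fun _ => ⟨fun h h' => one_ne_two (h'.symm.trans h), fun h => ?_⟩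
      exact eq_two_of_ne_one h
    have h3 := approx_le_integral m t η (continuous_allCriticalIndicator {x})
      (monotone_allCriticalIndicator {x})
    rw [approx_singleton, h2, integral_allCriticalIndicator] at h3
    exact (hm t le_rfl).trans
      ((expect_isCritical_mono (Nat.zero_le m) subset_rfl t.2).trans h3)
  have h4 : ∀ᵐ ξ ∂(limitLaw t η), ξ = allTwo := by
    have : ∀ x : ℤ, ∀ᵐ ξ ∂(limitLaw t η), ξ x = two := by
      intro x
      have h5 : limitLaw t η (allCritical {x}) = 1 := by
        rw [← ofReal_measureReal, h1 x, ENNReal.ofReal_one]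
      filter_upwards [(mem_ae_iff_prob_eq_one (measurableSet_allCritical {x})).2 h5] with ξ hξ
      exact hξ x (Finset.mem_singleton_self x)
    filter_upwards [ae_all_iff.2 this] with ξ hξ
    exact funext hξ
  refine measure_ext_of_allCritical fun C => ?_
  rw [← integral_allCriticalIndicator, ← integral_allCriticalIndicator, integral_dirac,
    integral_congr_ae (g := fun _ => allCriticalIndicator C allTwo)
      (h4.mono fun ξ hξ => by simp only [hξ])]
  simp

lemma allCriticalIndicator_allTwo (C : Finset ℤ) : allCriticalIndicator C allTwo = 1 :=
  Set.indicator_of_mem (show allTwo ∈ allCritical C from fun _ _ => rfl) _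

lemma integral_limitLaw_eq_one {η : Config} (hη : (ones η).Finite) {t : ℝ≥0} (ht : 0 < t)
    (C : Finset ℤ) : ∫ ξ, allCriticalIndicator C ξ ∂(limitLaw t η) = 1 := by
  rw [limitLaw_eq_dirac hη ht, integral_dirac, allCriticalIndicator_allTwo]

/-! ### Failure of the Feller property -/

/-- A single site of height one at the origin is gone at every positive time. -/
theorem not_continuousAtZero : ¬ ContinuousAtZero sandpileKernel := by
  intro h
  set η : Config := Function.update allTwo 0 one with hη
  have h1 : (ones η).Finite := by
    refine (Set.finite_singleton (0 : ℤ)).subset fun x hx => ?_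
    by_contra hne
    have : η x = two := Function.update_of_ne hne _ _
    exact one_ne_two (Eq.trans (Eq.symm hx) this)
  have h2 := h _ (continuous_allCriticalIndicator {0}) η
  have h3 : allCriticalIndicator {0} η = 0 := by
    refine Set.indicator_of_notMem (fun hm => ?_) _
    have h4 : η 0 = two := hm 0 (Finset.mem_singleton_self 0)
    rw [hη, Function.update_self] at h4
    exact one_ne_two h4
  rw [h3] at h2
  have h5 : Tendsto (fun t : ℝ≥0 => ∫ ξ, allCriticalIndicator {0} ξ ∂(sandpileKernel t η))
      (𝓝[>] 0) (𝓝 1) := by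
    apply tendsto_const_nhds.congr'
    filter_upwards [self_mem_nhdsWithin] with t ht
    exact (integral_limitLaw_eq_one h1 ht {0}).symm
  exact zero_ne_one (tendsto_nhds_unique h2 h5)

/-- For small times the sandpile process started from the configuration without critical sites has
sites of height one. -/
theorem integral_limitLaw_ofCritical_empty_ne_one :
    ∫ ξ, allCriticalIndicator {0} ξ ∂(limitLaw (1 / 4) (ofCritical ∅)) ≠ 1 := by
  intro h
  have hcrit : ∀ n, critical n (ofCritical ∅) = ∅ := fun n =>
    Finset.subset_empty.1 (critical_ofCritical_subset n ∅)
  have h1 := tendsto_approx (1 / 4) (ofCritical ∅) (continuous_allCriticalIndicator {0})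
    (monotone_allCriticalIndicator {0})
  rw [h] at h1
  obtain ⟨n, hn⟩ := (h1.eventually (lt_mem_nhds (show (3 / 4 : ℝ) < 1 by norm_num))).exists
  rw [approx_singleton, hcrit] at hn
  have ht : (0 : ℝ) ≤ ((1 / 4 : ℝ≥0) : ℝ) := NNReal.coe_nonneg _
  -- This size makes `(2N + 1) * 3/4 = 3n + 9/4` exceed `(2(n + N) + 1) * 1/2 = 3n + 3/2`, the two
  -- bounds on the expected number of critical sites in `[-N, N]`.
  set N : ℕ := 2 * n + 1 with hN
  -- For `|x| ≤ N` the window `[-n, n]` translated by `x` lies in `[-(n + N), n + N]`, so the bound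
  -- at the origin carries over to `x`.
  have h2 : ∀ x ∈ Finset.Icc (-(N : ℤ)) N,
      (3 / 4 : ℝ) ≤ expect (n + N) ((1 / 4 : ℝ≥0) : ℝ) (isCritical x) ∅ := by
    intro x hx
    refine hn.le.trans (expect_le_expect_of_shift (x := x) (fun y hy => ?_) (abs_isCritical_le 0)
      (abs_isCritical_le x) (fun A A' hA => ?_) (by simp) ht)
    · rw [Finset.mem_Icc] at hx hy ⊢
      push_cast
      omega
    · by_cases h0 : (0 : ℤ) ∈ A
      · have : x ∈ A' := by simpa using hA 0 h0
        rw [isCritical, isCritical, if_pos h0, if_pos this]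
      · rw [isCritical, if_neg h0]
        exact isCritical_nonneg x A'
  have h3 := (Finset.card_nsmul_le_sum _ _ _ h2).trans (sum_expect_isCritical_le (n + N) _ ht)
  have h4 : Real.exp ((1 / 4 : ℝ≥0) : ℝ) ≤ 3 / 2 := by
    have h5 := Real.exp_bound_div_one_sub_of_interval ht (by norm_num [NNReal.coe_div])
    refine h5.trans ?_
    norm_num [NNReal.coe_div]
  have h6 : (Finset.Icc (-(N : ℤ)) N).card = 2 * N + 1 := by
    rw [Int.card_Icc]
    omega
  rw [h6, nsmul_eq_mul] at h3
  have h7 : (2 * ((n + N : ℕ) : ℝ) + 1) * (Real.exp ((1 / 4 : ℝ≥0) : ℝ) - 1) ≤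
      (2 * ((n + N : ℕ) : ℝ) + 1) * (1 / 2) := by
    gcongr
    linarith
  have h8 := h3.trans h7
  rw [hN] at h8
  push_cast at h8
  linarith

theorem not_fellerProperty : ¬ FellerProperty sandpileKernel := by
  intro h
  have h1 := h (1 / 4) _ (continuous_allCriticalIndicator {0})
  set η : ℕ → Config := fun k x => if x ∈ Finset.Icc (-(k : ℤ)) k then one else two with hη
  have h2 : Tendsto η atTop (𝓝 (ofCritical ∅)) := by
    rw [tendsto_pi_nhds]
    intro x
    apply tendsto_const_nhds.congr'
    filter_upwards [eventually_ge_atTop x.natAbs] with k hk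
    have hx : x ∈ Finset.Icc (-(k : ℤ)) k := Finset.mem_Icc.2 (by omega)
    simp only [hη]
    rw [if_pos hx]
    rfl
  have h3 : ∀ k, (ones (η k)).Finite := by
    intro k
    refine (Finset.finite_toSet (Finset.Icc (-(k : ℤ)) k)).subset fun x hx => ?_
    by_contra hne
    have : η k x = two := if_neg hne
    exact one_ne_two (Eq.trans (Eq.symm hx) this)
  have h4 := (h1.tendsto (ofCritical ∅)).comp h2
  have h5 : Tendsto (fun _ : ℕ => (1 : ℝ)) atTop
      (𝓝 (∫ ξ, allCriticalIndicator {0} ξ ∂(sandpileKernel (1 / 4) (ofCritical ∅)))) :=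
    h4.congr fun k => integral_limitLaw_eq_one (h3 k) (by positivity) {0}
  exact integral_limitLaw_ofCritical_empty_ne_one (tendsto_nhds_unique h5 tendsto_const_nhds)

/-! ### Versions of the process -/

lemma ones_allTwo : ones allTwo = ∅ :=
  Set.eq_empty_of_forall_notMem fun _ hx => one_ne_two (Eq.symm hx)

/-- The path that jumps from `η` to the configuration of critical sites immediately after time
zero. -/
def jumpPath (η : Config) (t : ℝ≥0) : Config := if t = 0 then η else allTwo

/-- Both states of the path have finitely many sites of height one, so either one leads to `allTwo`
after any positive time. -/
lemma sandpileKernel_jumpPath {η : Config} (hη : (ones η).Finite) (s t : ℝ≥0) :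
    sandpileKernel t (jumpPath η s) = Measure.dirac (jumpPath η (s + t)) := by
  rcases eq_or_ne t 0 with rfl | ht
  · rw [sandpileKernel_zero, Kernel.id_apply, add_zero]
  · have h1 : (ones (jumpPath η s)).Finite := by
      unfold jumpPath
      split_ifs
      · exact hη
      · rw [ones_allTwo]
        exact Set.finite_empty
    have h2 : jumpPath η (s + t) = allTwo := if_neg (by simp [ht])
    rw [h2]
    exact limitLaw_eq_dirac h1 (pos_iff_ne_zero.2 ht)

theorem isVersion_jumpPath {η : Config} (hη : (ones η).Finite) :
    IsVersion sandpileKernel η (Measure.dirac ()) (fun t _ => jumpPath η t) where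
  isProbabilityMeasure := inferInstance
  measurable t := measurable_const
  initial := Eventually.of_forall fun _ => if_pos rfl
  markov s t B hB := by
    have hm : past (fun t (_ : Unit) => jumpPath η t) s ≤ (inferInstance : MeasurableSpace Unit) :=
      iSup₂_le fun r _ => measurable_const.comap_le
    have h1 : ((fun _ : Unit => jumpPath η (s + t)) ⁻¹' B).indicator (fun _ => (1 : ℝ)) =
        fun _ => (sandpileKernel t (jumpPath η s)).real B := by
      funext ω
      rw [sandpileKernel_jumpPath hη, measureReal_def, Measure.dirac_apply' _ hB]
      by_cases h : jumpPath η (s + t) ∈ B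
      · simp [Set.indicator, h]
      · simp [Set.indicator, h]
    rw [h1, condExp_const hm]

/-- The Markov property at `s = 0` is integrated, so only the one-time law started from `η` enters.
-/
lemma IsVersion.ae_eq_allTwo {η : Config} (hη : (ones η).Finite) {S : Type*} [MeasurableSpace S]
    {μ : Measure S} {X : ℝ≥0 → S → Config} (hX : IsVersion sandpileKernel η μ X) {t : ℝ≥0}
    (ht : 0 < t) : ∀ᵐ ω ∂μ, X t ω = allTwo := by
  have := hX.isProbabilityMeasure
  have hB : MeasurableSet ({allTwo} : Set Config) := measurableSet_singleton _
  have hm : past X 0 ≤ (inferInstance : MeasurableSpace S) :=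
    iSup₂_le fun r _ => (hX.measurable r).comap_le
  have h1 := integral_congr_ae (hX.markov 0 t _ hB)
  have h0 : ∫ ω, (X (0 + t) ⁻¹' {allTwo}).indicator (fun _ => (1 : ℝ)) ω ∂μ =
      μ.real (X (0 + t) ⁻¹' {allTwo}) := integral_indicator_one ((hX.measurable _) hB)
  rw [integral_condExp hm, h0, zero_add] at h1
  have h2 : ∫ ω, (sandpileKernel t (X 0 ω)).real {allTwo} ∂μ = 1 := by
    rw [integral_congr_ae (g := fun _ => (1 : ℝ))]
    · simp
    · filter_upwards [hX.initial] with ω hω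
      rw [hω, sandpileKernel_apply, limitLaw_eq_dirac hη ht, measureReal_def,
        Measure.dirac_apply' _ hB]
      simp
  rw [h2] at h1
  have h3 : μ (X t ⁻¹' {allTwo}) = 1 := by
    rw [← ofReal_measureReal, h1, ENNReal.ofReal_one]
  exact (mem_ae_iff_prob_eq_one ((hX.measurable t) hB)).2 h3

/-- Almost every path equals `allTwo` at all the countably many times `1 / (k + 1)`.
Right-continuity at zero would force `η = allTwo`. -/
theorem IsVersion.not_hasRightContinuousPaths {η : Config} (hη : (ones η).Finite)
    (hη' : (ones η).Nonempty) {S : Type*} [MeasurableSpace S] {μ : Measure S}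
    {X : ℝ≥0 → S → Config} (hX : IsVersion sandpileKernel η μ X) :
    ¬ HasRightContinuousPaths μ X := by
  intro h
  have := hX.isProbabilityMeasure
  have h1 : ∀ᵐ ω ∂μ, ∀ k : ℕ, X (1 / ((k : ℝ≥0) + 1)) ω = allTwo :=
    ae_all_iff.2 fun k => hX.ae_eq_allTwo hη (by positivity)
  obtain ⟨ω, hω, hω0, hω1⟩ := (h.and (hX.initial.and h1)).exists
  have h2 : Tendsto (fun k : ℕ => 1 / ((k : ℝ≥0) + 1)) atTop (𝓝[Set.Ici 0] 0) :=
    tendsto_nhdsWithin_iff.2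
      ⟨tendsto_one_div_add_atTop_nhds_zero_nat, Eventually.of_forall fun k => Set.mem_Ici.2 zero_le⟩
  have h3 : Tendsto (fun k : ℕ => X (1 / ((k : ℝ≥0) + 1)) ω) atTop (𝓝 (X 0 ω)) :=
    Tendsto.comp (hω 0) h2
  simp_rw [hω1] at h3
  have h4 : allTwo = η := hω0 ▸ tendsto_nhds_unique tendsto_const_nhds h3
  rw [← h4, ones_allTwo] at hη'
  exact Set.not_nonempty_empty hη'

end Sandpile

end

theorem corollary5p1 :
    ∃ P : ℝ≥0 → Kernel Sandpile.Config Sandpile.Config,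
      Sandpile.IsSandpileSemigroup P ∧
      (∀ Q : ℝ≥0 → Kernel Sandpile.Config Sandpile.Config,
        Sandpile.IsSandpileSemigroup Q → Q = P) ∧
      ¬ Sandpile.FellerProperty P ∧
      ¬ Sandpile.ContinuousAtZero P ∧
      ∀ η : Sandpile.Config, (Sandpile.ones η).Finite → (Sandpile.ones η).Nonempty →
        (∃ (S : Type) (_ : MeasurableSpace S) (μ : Measure S) (X : ℝ≥0 → S → Sandpile.Config),
          Sandpile.IsVersion P η μ X) ∧
        ∀ (S : Type*) [MeasurableSpace S] (μ : Measure S) (X : ℝ≥0 → S → Sandpile.Config),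
          Sandpile.IsVersion P η μ X → ¬ Sandpile.HasRightContinuousPaths μ X := by
  refine ⟨Sandpile.sandpileKernel, Sandpile.isSandpileSemigroup_sandpileKernel,
    fun Q hQ => Sandpile.isSandpileSemigroup_sandpileKernel.unique hQ,
    Sandpile.not_fellerProperty, Sandpile.not_continuousAtZero, fun η hη hη' => ⟨?_, ?_⟩⟩
  · exact ⟨Unit, inferInstance, Measure.dirac (), fun t _ => Sandpile.jumpPath η t,
      Sandpile.isVersion_jumpPath hη⟩
  · intro S _ μ X hX
    exact hX.not_hasRightContinuousPaths hη hη'
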